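/- Let $d\ge 2$ and let $\mathbb T^d=\mathbb R^d/\mathbb Z^d$, with Lebesgue measure $|\cdot|$ of total mass $1$. For a smooth divergence-free vector field $u:[0,\infty)\times\mathbb T^d\to\mathbb R^d$ with compact support in time and a finite positive Borel measure $\mu$ on $\mathbb T^d$, let $\mathcal P^u_t\mu$, $t\ge 0$, denote the solution at time $t$ of $$\partial_t\theta=\Delta\theta-u\cdot\nabla\theta,\qquad \theta(0)=\mu,$$ that is, the weakly continuous curve $t\mapsto\theta_t$ of finite positive Borel measures on $\mathbb T^d$ with $\theta_0=\mu$ and $\frac{\mathrm d}{\mathrm dt}\int\psi\,\mathrm d\theta_t=\int(\Delta\psi+u(t,\cdot)\cdot\nabla\psi)\,\mathrm d\theta_t$ for all $\psi\in C^\infty(\mathbb T^d)$ and $t>0$; write $\mathrm e^{t\Delta}\mu=\mathcal P^0_t\mu$. For finite positive Borel measures $\mu,\nu$ on $\mathbb T^d$ write $\mu\preceq\nu$ if $C_\mu(\alpha)\le C_\nu(\alpha)$ for all $\alpha\in[0,\infty)$, where $C_\mu(\alpha)=\sup\{\mu(E): E\subseteq\mathbb T^d\text{ Borel},\ |E|=\alpha\}$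 (with $\sup\emptyset=0$). The $L^2(\mathbb T^d)$ norm of a measure is that of its density, and $+\infty$ if it has none. **Theorem.** There exist a divergence-free vector field $u\in C^\infty([0,\infty)\times\mathbb T^d;\mathbb R^d)$ with compact support in time and a $T>0$ such that the solutions $\mathcal P^u_t\delta_0$ and $\mathrm e^{t\Delta}\delta_0$ exist and are unique, where $\delta_0$ is the Dirac mass at $0$, and for all $t\ge T$ $$\|\mathrm e^{t\Delta}\delta_0\|_{L^2(\mathbb T^d)}<\|\mathcal P^u_t\delta_0\|_{L^2(\mathbb T^d)}<\infty .$$ In particular, for all $t>T$, $\mathcal P^u_t\delta_0\not\preceq \mathrm e^{t\Delta}\delta_0$. -/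

import Mathlib

open MeasureTheory Set
open scoped ContDiff ENNReal NNReal

noncomputable section

/-- The flat torus `𝕋^d = ℝ^d / ℤ^d`; its `volume` is Lebesgue measure, of total mass `1`. -/
abbrev FlatTorus (d : ℕ) : Type := UnitAddTorus (Fin d)

/-- The covering map `ℝ^d → 𝕋^d`. -/
def FlatTorus.proj {d : ℕ} (y : Fin d → ℝ) : FlatTorus d := fun i => (y i : UnitAddCircle)

/-- The partial derivative `∂_i f` of a function on the torus. -/
def FlatTorus.partialDeriv {d : ℕ} (i : Fin d) (f : FlatTorus d → ℝ) (x : FlatTorus d) : ℝ :=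
  deriv (fun s : ℝ => f (x + Pi.single i (s : UnitAddCircle))) 0

/-- The Laplacian `Δf = ∑_i ∂_i ∂_i f` of a function on the torus. -/
def FlatTorus.laplace {d : ℕ} (f : FlatTorus d → ℝ) (x : FlatTorus d) : ℝ :=
  ∑ i, FlatTorus.partialDeriv i (FlatTorus.partialDeriv i f) x

/-- The divergence `∑_i ∂_i v_i` of a vector field on the torus. -/
def FlatTorus.divergence {d : ℕ} (v : FlatTorus d → Fin d → ℝ) (x : FlatTorus d) : ℝ :=
  ∑ i, FlatTorus.partialDeriv i (fun y => v y i) x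

/-- `f ∈ C^∞(𝕋^d)`: the periodic lift of `f` to `ℝ^d` is smooth. -/
def FlatTorus.IsSmooth {d : ℕ} (f : FlatTorus d → ℝ) : Prop :=
  ContDiff ℝ ∞ (fun y : Fin d → ℝ => f (FlatTorus.proj y))

/-- `u ∈ C^∞([0,∞) × 𝕋^d; ℝ^d)`, jointly in time and space and up to time `0`. Only the values
of `u` at times `t ≥ 0` matter, here and below. -/
def FlatTorus.IsSmoothField {d : ℕ} (u : ℝ → FlatTorus d → Fin d → ℝ) : Prop :=
  ContDiffOn ℝ ∞ (fun p : ℝ × (Fin d → ℝ) => u p.1 (FlatTorus.proj p.2)) (Ici 0 ×ˢ univ)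

/-- `θ : [0,∞) → ℳ₊(𝕋^d)` solves `∂_t θ = Δθ - u·∇θ`, `θ(0) = μ`, for a smooth (in time and space)
divergence-free `u`: the curve `θ` is continuous for the weak topology of measures, starts at `μ`,
and solves the equation in the sense of distributions on `𝕋^d`. As `u` is divergence-free,
`u·∇θ = div(uθ)`, whose pairing with a test function `ψ` is `-∫ u·∇ψ dθ`. -/
structure FlatTorus.IsSolution {d : ℕ} (u : ℝ → FlatTorus d → Fin d → ℝ)
    (μ : FiniteMeasure (FlatTorus d)) (θ : ℝ → FiniteMeasure (FlatTorus d)) : Prop where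
  continuousOn : ContinuousOn θ (Ici 0)
  initial : θ 0 = μ
  equation : ∀ ψ : FlatTorus d → ℝ, FlatTorus.IsSmooth ψ → ∀ t : ℝ, 0 < t →
    HasDerivAt (fun s : ℝ => ∫ x, ψ x ∂(θ s : Measure (FlatTorus d)))
      (∫ x, (FlatTorus.laplace ψ x + ∑ i, u t x i * FlatTorus.partialDeriv i ψ x)
        ∂(θ t : Measure (FlatTorus d))) t

/-- `θ(t) = 𝒫ᵘ_t μ` for all `t ≥ 0`: `θ` is the one and only solution of the advection-diffusion
equation with drift `u` and initial condition `μ`. For `u = 0` this says `θ(t) = e^{tΔ} μ`. -/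
def FlatTorus.IsTheSolution {d : ℕ} (u : ℝ → FlatTorus d → Fin d → ℝ)
    (μ : FiniteMeasure (FlatTorus d)) (θ : ℝ → FiniteMeasure (FlatTorus d)) : Prop :=
  FlatTorus.IsSolution u μ θ ∧
    ∀ θ' : ℝ → FiniteMeasure (FlatTorus d), FlatTorus.IsSolution u μ θ' → EqOn θ' θ (Ici 0)

/-- The Dirac mass `δ_0` at the origin of the torus. -/
def FlatTorus.diracZero (d : ℕ) : FiniteMeasure (FlatTorus d) :=
  ⟨Measure.dirac 0, inferInstance⟩

open Classical in
/-- The `L²(𝕋^d)` norm of a measure: that of its density if it has one, and `∞` otherwise. -/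
def FlatTorus.l2Norm {d : ℕ} (μ : FiniteMeasure (FlatTorus d)) : ℝ≥0∞ :=
  if (μ : Measure (FlatTorus d)) ≪ volume then
    eLpNorm ((μ : Measure (FlatTorus d)).rnDeriv volume) 2 volume
  else ⊤

/-- The modulus of absolute continuity `C_μ(α) = sup {μ(E) : E Borel, |E| = α}`. -/
def FlatTorus.modulus {d : ℕ} (μ : FiniteMeasure (FlatTorus d)) (α : ℝ≥0) : ℝ≥0∞ :=
  ⨆ (E : Set (FlatTorus d)) (_ : MeasurableSet E) (_ : volume E = (α : ℝ≥0∞)),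
    (μ : Measure (FlatTorus d)) E

/-- `μ ⪯ ν`: `μ` is less concentrated than `ν`. -/
def FlatTorus.LessConcentrated {d : ℕ} (μ ν : FiniteMeasure (FlatTorus d)) : Prop :=
  ∀ α : ℝ≥0, FlatTorus.modulus μ α ≤ FlatTorus.modulus ν α

end

/-!
The drift is a weak shear `u(t,x) = ρ(t) sin(2π m·x) w` with `m = e_i + 2 e_j`, `w = 2 e_i - e_j`,
switched on only during a bounded time interval `[t₀, t₀ + 2]` with `t₀` large. For such a drift the
equation closes on Fourier coefficients: the numbers `c_k(t) = ∫ e^{2πi k·x} dθ_t` satisfy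

  `c_k' = -4π²|k|² c_k + π ρ(t) (k·w) (c_{k+m} - c_{k-m})`,  `c_k(0) = 1`,

a real linear system in which the dissipation absorbs the coupling, because `|k·w| ≤ C |k|²`.

* Well-posedness. A bounded solution of `z' = -a z + g`, `z(0) = 0`, satisfies `|z| ≤ sup |g| / a`
  (`abs_le_of_relaxation`). For a weak shear this makes the difference of two bounded solutions
  halve its own bound, so it vanishes (`CoeffODE.unique`), and it makes the Duhamel map a
  contraction in a space of sequences with exponential weights, so that solutions exist and are
  close to the heat flow (`exists_coeffODE`). Positivity needs no maximum principle: at times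
  `t ≥ t₀` the heat kernel is at least `1/2`, and the solution is a small perturbation of it
  (`exists_density_of_coeff`); before `t₀` the solution is the heat kernel itself, the projection
  of a Gaussian. Conversely, Fourier coefficients solving the system give a solution in the sense
  of distributions, since smooth functions have absolutely summable Fourier coefficients, also
  after differentiation (`isSolution_shear_of_coeffODE`).
* Gain in the first modes. The heat kernel decays like its modes `±e_l`, which carry the factor
  `q = e^{-4π²t}`. While the shear acts, the derivative of `(c_{e_i} + c_{e_j}) / q` is to leading
  order a positive multiple of `q² - 2q⁴ + 2q⁸ - q¹⁰ > 0` (`coupling_add_coupling_ge`). Hence this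
  sum, which equals `2` for the heat flow, ends up above some `Y > 2` and stays there
  (`exists_lt_exp_mul_add`). By Parseval the squared `L²` norm then exceeds that of the heat kernel
  by at least `(Y² - 4) q² - O(q⁴)`, which is positive for large `t` (`sum_sq_gt`).
* Concentration. Testing `μ ⪯ ν` on superlevel sets gives `∫ (f - s)₊ ≤ ∫ (g - s)₊` for the
  densities, and integrating over `s` gives `∫ f² ≤ ∫ g²` (`integral_sq_le_of_lessConcentrated`).
-/

namespace FlatTorus

open UnitAddTorus Filter Topology

variable {d : ℕ}

/-! ### Fourier coefficients of measures and of continuous functions -/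

instance isProbabilityMeasure_volume_unitAddCircle :
    IsProbabilityMeasure (volume : Measure UnitAddCircle) :=
  ⟨by simp⟩

theorem norm_mFourier_apply (k : Fin d → ℤ) (x : FlatTorus d) : ‖mFourier k x‖ = 1 := by
  simp only [mFourier, ContinuousMap.coe_mk, norm_prod, fourier_apply, Circle.norm_coe,
    Finset.prod_const_one]

theorem mFourier_add_single (k : Fin d → ℤ) (x : FlatTorus d) (i : Fin d) (s : UnitAddCircle) :
    mFourier k (x + Pi.single i s) = fourier (k i) s * mFourier k x := by
  have h : ∀ j, fourier (k j) ((x + Pi.single i s : FlatTorus d) j)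
      = (if j = i then fourier (k i) s else 1) * fourier (k j) (x j) := by
    intro j
    by_cases hj : j = i
    · subst hj
      simp [fourier_apply, smul_add, AddCircle.toCircle_add, mul_comm]
    · simp [hj]
  simp only [mFourier, ContinuousMap.coe_mk, h, Finset.prod_mul_distrib, Finset.prod_ite_eq',
    Finset.mem_univ, if_true]

theorem mFourier_apply_zero (k : Fin d → ℤ) : mFourier k (0 : FlatTorus d) = 1 := by
  simp [mFourier]

theorem mFourier_proj (k : Fin d → ℤ) (y : Fin d → ℝ) :
    mFourier k (proj y) = Complex.exp ((2 * Real.pi * ∑ j, (k j : ℝ) * y j : ℝ) * Complex.I) := by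
  simp only [mFourier, ContinuousMap.coe_mk, proj, fourier_coe_apply, ← Complex.exp_sum]
  congr 1
  push_cast
  rw [Finset.mul_sum, Finset.sum_mul]
  refine Finset.sum_congr rfl fun j _ => ?_
  ring

theorem hasDerivAt_mFourier_line (k : Fin d → ℤ) (x : FlatTorus d) (i : Fin d) :
    HasDerivAt (fun s : ℝ => mFourier k (x + Pi.single i (s : UnitAddCircle)))
      (2 * Real.pi * Complex.I * k i * mFourier k x) 0 := by
  simp only [mFourier_add_single]
  have := (hasDerivAt_fourier 1 (k i) 0).mul_const (mFourier k x)
  simpa using this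

theorem integrable_continuousMap (μ : Measure (FlatTorus d)) [IsFiniteMeasure μ]
    (f : C(FlatTorus d, ℂ)) : Integrable f μ :=
  (BoundedContinuousFunction.mkOfCompact f).integrable μ

theorem integral_mFourier_of_ne_zero {k : Fin d → ℤ} (hk : k ≠ 0) :
    ∫ x : FlatTorus d, mFourier k x = 0 := by
  obtain ⟨i, hi⟩ := Function.ne_iff.mp hk
  -- translation by half a period changes the sign of the integrand
  have h := integral_add_right_eq_self (μ := (volume : Measure (FlatTorus d)))
    (fun x => mFourier k x) (Pi.single i (((1 : ℝ) / 2 / (k i) : ℝ) : UnitAddCircle))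
  have h2 : fourier (k i) (((1 : ℝ) / 2 / (k i) : ℝ) : UnitAddCircle) = -1 := by
    have := fourier_add_half_inv_index (T := 1) hi one_pos 0
    simpa using this
  simp only [mFourier_add_single, h2, integral_const_mul] at h
  linear_combination (-1 / 2 : ℂ) * h

theorem integral_mFourier (k : Fin d → ℤ) :
    ∫ x : FlatTorus d, mFourier k x = if k = 0 then 1 else 0 := by
  split_ifs with h
  · subst h
    simp [mFourier_zero]
  · exact integral_mFourier_of_ne_zero h

theorem exists_mem_span_norm_sub_le (f : C(FlatTorus d, ℂ)) {ε : ℝ} (hε : 0 < ε) :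
    ∃ p ∈ Submodule.span ℂ (range (mFourier (d := Fin d))), ‖f - p‖ < ε := by
  have : f ∈ (Submodule.span ℂ (range (mFourier (d := Fin d)))).topologicalClosure := by
    rw [span_mFourier_closure_eq_top]; trivial
  obtain ⟨p, hp, h⟩ := Metric.mem_closure_iff.1 this ε hε
  exact ⟨p, hp, by rwa [dist_eq_norm] at h⟩

theorem norm_integral_le_mass (μ : FiniteMeasure (FlatTorus d)) (f : C(FlatTorus d, ℂ)) :
    ‖∫ x, f x ∂(μ : Measure (FlatTorus d))‖ ≤ ‖f‖ * μ.mass :=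
  norm_integral_le_of_norm_le_const (Eventually.of_forall f.norm_coe_le_norm)

theorem integral_mFourier_zero (μ : FiniteMeasure (FlatTorus d)) :
    ∫ x, mFourier (0 : Fin d → ℤ) x ∂(μ : Measure (FlatTorus d)) = ((μ.mass : ℝ) : ℂ) := by
  simp only [mFourier_zero, ContinuousMap.one_apply, integral_const, Complex.real_smul, mul_one]
  rfl

/-- Convergence of all Fourier coefficients implies weak convergence of finite measures: the
masses are the coefficients at `0`, hence bounded, and trigonometric polynomials are dense. -/
theorem tendsto_of_tendsto_integral_mFourier {γ : Type*} {l : Filter γ}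
    {μs : γ → FiniteMeasure (FlatTorus d)} {μ : FiniteMeasure (FlatTorus d)}
    (h : ∀ k : Fin d → ℤ, Tendsto (fun a => ∫ x, mFourier k x ∂(μs a : Measure (FlatTorus d))) l
      (𝓝 (∫ x, mFourier k x ∂(μ : Measure (FlatTorus d))))) :
    Tendsto μs l (𝓝 μ) := by
  have hmass : Tendsto (fun a => ((μs a).mass : ℝ)) l (𝓝 (μ.mass : ℝ)) := by
    have := (Complex.continuous_re.tendsto _).comp (h 0)
    simpa only [Function.comp_def, integral_mFourier_zero, Complex.ofReal_re] using this
  have hspan : ∀ p ∈ Submodule.span ℂ (range (mFourier (d := Fin d))),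
      Tendsto (fun a => ∫ x, p x ∂(μs a : Measure (FlatTorus d))) l
      (𝓝 (∫ x, p x ∂(μ : Measure (FlatTorus d)))) := by
    intro p hp
    induction hp using Submodule.span_induction with
    | mem p hp => obtain ⟨k, rfl⟩ := hp; exact h k
    | zero => simpa using tendsto_const_nhds
    | add p q _ _ hp hq =>
      simp only [ContinuousMap.add_apply]
      simp_rw [fun ν : FiniteMeasure (FlatTorus d) => integral_add
        (integrable_continuousMap (ν : Measure (FlatTorus d)) p)
        (integrable_continuousMap (ν : Measure (FlatTorus d)) q)]
      exact hp.add hq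
    | smul c p _ hp =>
      simp only [ContinuousMap.smul_apply, integral_smul]
      exact hp.const_smul c
  rw [FiniteMeasure.tendsto_iff_forall_integral_rclike_tendsto ℂ]
  intro f
  rw [Metric.tendsto_nhds]
  intro ε hε
  set M : ℝ := μ.mass + 1 with hM
  have hM0 : 0 < M := by positivity
  obtain ⟨p, hp, hfp⟩ := exists_mem_span_norm_sub_le f.toContinuousMap
    (show 0 < ε / (4 * M) by positivity)
  have key : ∀ ν : FiniteMeasure (FlatTorus d), (ν.mass : ℝ) ≤ M →
      ‖∫ x, f x ∂(ν : Measure (FlatTorus d)) - ∫ x, p x ∂(ν : Measure (FlatTorus d))‖ ≤ ε / 4 := by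
    intro ν hν
    have h1 : ∫ x, f x ∂(ν : Measure (FlatTorus d)) - ∫ x, p x ∂(ν : Measure (FlatTorus d))
        = ∫ x, (f.toContinuousMap - p) x ∂(ν : Measure (FlatTorus d)) :=
      (integral_sub (integrable_continuousMap _ f.toContinuousMap)
        (integrable_continuousMap _ p)).symm
    rw [h1]
    refine (norm_integral_le_mass ν _).trans ?_
    calc ‖f.toContinuousMap - p‖ * ν.mass ≤ ε / (4 * M) * M := by gcongr
      _ = ε / 4 := by field_simp
  have h1 := (Metric.tendsto_nhds.1 (hspan p hp)) (ε / 4) (by positivity)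
  have h2 : ∀ᶠ a in l, ((μs a).mass : ℝ) < M := hmass.eventually_lt_const (by simp [hM])
  filter_upwards [h1, h2] with a ha1 ha2
  rw [dist_eq_norm] at ha1 ⊢
  have e1 := key (μs a) ha2.le
  have e2 := key μ (by simp [hM])
  set A := ∫ x, f x ∂(μs a : Measure (FlatTorus d))
  set B := ∫ x, p x ∂(μs a : Measure (FlatTorus d))
  set C := ∫ x, p x ∂(μ : Measure (FlatTorus d))
  set D := ∫ x, f x ∂(μ : Measure (FlatTorus d))
  have : A - D = (A - B) + (B - C) - (D - C) := by ring
  rw [this]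
  calc _ ≤ ‖(A - B) + (B - C)‖ + ‖D - C‖ := norm_sub_le _ _
    _ ≤ ‖A - B‖ + ‖B - C‖ + ‖D - C‖ := by gcongr; exact norm_add_le _ _
    _ < ε := by linarith

/-- A finite measure on the torus is determined by its Fourier coefficients. -/
theorem ext_of_integral_mFourier {μ ν : FiniteMeasure (FlatTorus d)}
    (h : ∀ k : Fin d → ℤ, ∫ x, mFourier k x ∂(μ : Measure (FlatTorus d))
      = ∫ x, mFourier k x ∂(ν : Measure (FlatTorus d))) : μ = ν := by
  have h1 : Tendsto (fun _ : ℕ => μ) atTop (𝓝 ν) :=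
    tendsto_of_tendsto_integral_mFourier fun k => by
      rw [h k]; exact tendsto_const_nhds
  exact tendsto_nhds_unique tendsto_const_nhds h1

/-- The Fourier coefficient `∫ e^{-2πi k·x} f(x) dx`, with respect to Lebesgue measure. Mathlib's
`mFourierCoeff` integrates against another instance of the same measure, which is not
definitionally equal to `volume`. -/
noncomputable def coeff (f : FlatTorus d → ℂ) (k : Fin d → ℤ) : ℂ := ∫ x, mFourier (-k) x * f x

theorem norm_coeff_le (f : C(FlatTorus d, ℂ)) (k : Fin d → ℤ) : ‖coeff f k‖ ≤ ‖f‖ := by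
  refine (norm_integral_le_of_norm_le_const (C := ‖f‖) (Eventually.of_forall fun x => ?_)).trans ?_
  · simpa [norm_mFourier_apply] using f.norm_coe_le_norm x
  · simp

theorem eq_zero_of_coeff_eq_zero {f : C(FlatTorus d, ℂ)} (h : ∀ k, coeff f k = 0) : f = 0 := by
  have hspan : ∀ p ∈ Submodule.span ℂ (range (mFourier (d := Fin d))),
      ∫ x : FlatTorus d, p x * f x = 0 := by
    intro p hp
    induction hp using Submodule.span_induction with
    | mem p hp => obtain ⟨k, rfl⟩ := hp; simpa [coeff] using h (-k)
    | zero => simp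
    | add p q _ _ hp hq =>
      simp only [ContinuousMap.add_apply, add_mul]
      have := integral_add (integrable_continuousMap volume (p * f))
        (integrable_continuousMap volume (q * f))
      simpa only [ContinuousMap.mul_apply, hp, hq, add_zero] using this
    | smul c p _ hp =>
      simp only [ContinuousMap.smul_apply, smul_eq_mul, mul_assoc, integral_const_mul, hp, mul_zero]
  have hall : ∀ g : C(FlatTorus d, ℂ), ∫ x : FlatTorus d, g x * f x = 0 := by
    intro g
    rw [← norm_le_zero_iff]
    refine le_of_forall_pos_le_add fun ε hε => ?_
    obtain ⟨p, hp, hgp⟩ := exists_mem_span_norm_sub_le g (show 0 < ε / (‖f‖ + 1) by positivity)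
    have e1 : ∫ x : FlatTorus d, g x * f x = ∫ x : FlatTorus d, ((g - p) * f) x := by
      have := integral_sub (integrable_continuousMap volume (g * f))
        (integrable_continuousMap volume (p * f))
      simp only [ContinuousMap.mul_apply, hspan p hp, sub_zero] at this
      rw [← this]
      simp [sub_mul]
    rw [e1, zero_add]
    refine (norm_integral_le_of_norm_le_const (Eventually.of_forall
      (ContinuousMap.norm_coe_le_norm _))).trans ?_
    simp only [probReal_univ, mul_one]
    calc ‖(g - p) * f‖ ≤ ‖g - p‖ * ‖f‖ := norm_mul_le _ _
      _ ≤ ε / (‖f‖ + 1) * (‖f‖ + 1) := by gcongr; linarith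
      _ = ε := by field_simp
  -- testing against the conjugate of `f` gives `∫ |f|² = 0`
  have h2 := hall (star f)
  have h3 : ∫ x : FlatTorus d, ‖f x‖ ^ 2 = 0 := by
    have : ∀ x, (star f) x * f x = ((‖f x‖ ^ 2 : ℝ) : ℂ) := fun x => by
      simpa using Complex.conj_mul' (f x)
    simp_rw [this] at h2
    have h3 : ∫ x : FlatTorus d, ((‖f x‖ ^ 2 : ℝ) : ℂ) = ((∫ x : FlatTorus d, ‖f x‖ ^ 2 : ℝ) : ℂ) :=
      integral_ofReal
    exact_mod_cast h3.symm.trans h2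
  have hcont : Continuous fun x : FlatTorus d => ‖f x‖ ^ 2 := by fun_prop
  rw [integral_eq_zero_iff_of_nonneg (fun x => by positivity)
    (hcont.integrable_of_hasCompactSupport (HasCompactSupport.of_compactSpace _))] at h3
  have h4 := (hcont.ae_eq_iff_eq volume continuous_zero).1 h3
  ext x
  simpa using congrFun h4 x

/-- An absolutely convergent trigonometric series, as a continuous function. -/
noncomputable def series (a : (Fin d → ℤ) → ℂ) : C(FlatTorus d, ℂ) := ∑' k, a k • mFourier k

theorem hasSum_series {a : (Fin d → ℤ) → ℂ} (ha : Summable fun k => ‖a k‖) :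
    HasSum (fun k => a k • (mFourier k : C(FlatTorus d, ℂ))) (series a) := by
  refine (Summable.of_norm ?_).hasSum
  simpa [norm_smul, mFourier_norm] using ha

theorem hasSum_series_apply {a : (Fin d → ℤ) → ℂ} (ha : Summable fun k => ‖a k‖) (x : FlatTorus d) :
    HasSum (fun k => a k * mFourier k x) (series a x) := by
  simpa using! (ContinuousMap.evalCLM ℂ x).hasSum (hasSum_series ha)

theorem hasSum_integral_of_bound {ι : Type*} [Countable ι] (μ : Measure (FlatTorus d))
    [IsFiniteMeasure μ] {g : ι → C(FlatTorus d, ℂ)} {G : FlatTorus d → ℂ} {b : ι → ℝ}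
    (hb : Summable b) (hg : ∀ k, ‖g k‖ ≤ b k) (hG : ∀ x, HasSum (fun k => g k x) (G x)) :
    HasSum (fun k => ∫ x, g k x ∂μ) (∫ x, G x ∂μ) := by
  have h := hasSum_integral_of_summable_integral_norm (μ := μ) (F := fun k x => g k x)
    (fun k => integrable_continuousMap μ (g k)) ?_
  · simpa only [(hG _).tsum_eq] using h
  · refine Summable.of_nonneg_of_le (fun k => integral_nonneg fun x => norm_nonneg _) (fun k => ?_)
      (hb.mul_right (μ.real univ))
    calc ∫ x, ‖g k x‖ ∂μ ≤ ∫ _, b k ∂μ :=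
          integral_mono (integrable_continuousMap μ (g k)).norm (integrable_const _)
            fun x => ((g k).norm_coe_le_norm x).trans (hg k)
      _ = b k * μ.real univ := by simp [mul_comm]

theorem hasSum_integral_series {a : (Fin d → ℤ) → ℂ} (ha : Summable fun k => ‖a k‖)
    (h : C(FlatTorus d, ℂ)) (μ : Measure (FlatTorus d)) [IsFiniteMeasure μ] :
    HasSum (fun k => a k * ∫ x, mFourier k x * h x ∂μ) (∫ x, series a x * h x ∂μ) := by
  have := hasSum_integral_of_bound μ (g := fun k => a k • (mFourier k * h))
    (G := fun x => series a x * h x) (b := fun k => ‖a k‖ * ‖h‖) (ha.mul_right _) (fun k => ?_)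
    (fun x => ?_)
  · simpa [integral_const_mul] using this
  · rw [norm_smul]
    gcongr
    calc _ ≤ _ := norm_mul_le _ _
      _ = ‖h‖ := by rw [mFourier_norm, one_mul]
  · simpa [mul_assoc] using (hasSum_series_apply ha x).mul_right (h x)

theorem coeff_series {a : (Fin d → ℤ) → ℂ} (ha : Summable fun k => ‖a k‖) (k : Fin d → ℤ) :
    coeff (series a) k = a k := by
  have h := hasSum_integral_series ha (mFourier (-k)) volume
  have h2 : HasSum (fun j => a j * ∫ x : FlatTorus d, mFourier j x * mFourier (-k) x) (a k) := by
    simp_rw [← mFourier_add, integral_mFourier]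
    convert hasSum_ite_eq k (a k) using 2 with j
    by_cases hj : j = k
    · simp [hj]
    · have : j + -k ≠ 0 := fun h0 => hj (by simpa using add_eq_zero_iff_eq_neg.1 h0)
      simp [hj, this]
  rw [← h.unique h2, coeff]
  simp_rw [mul_comm]

/-- A continuous function with absolutely summable Fourier coefficients is the sum of its Fourier
series. -/
theorem hasSum_coeff_mul_mFourier {f : C(FlatTorus d, ℂ)} (hf : Summable fun k => ‖coeff f k‖)
    (x : FlatTorus d) : HasSum (fun k => coeff f k * mFourier k x) (f x) := by
  have : f - series (coeff f) = 0 := by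
    refine eq_zero_of_coeff_eq_zero fun k => ?_
    have h1 : coeff (f - series (coeff f)) k = coeff f k - coeff (series (coeff f)) k := by
      have := integral_sub (integrable_continuousMap volume (mFourier (-k) * f))
        (integrable_continuousMap volume (mFourier (-k) * series (coeff f)))
      simpa only [coeff, ContinuousMap.mul_apply, ContinuousMap.sub_apply, mul_sub] using this
    rw [h1, coeff_series hf, sub_self]
  have h2 := hasSum_series_apply hf x
  rwa [← sub_eq_zero.1 this] at h2

/-! ### Smooth functions and the decay of their Fourier coefficients -/

theorem isOpenQuotientMap_proj : IsOpenQuotientMap (proj : (Fin d → ℝ) → FlatTorus d) :=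
  IsOpenQuotientMap.piMap (f := fun (_ : Fin d) (y : ℝ) => (y : UnitAddCircle))
    fun _ => QuotientAddGroup.isOpenQuotientMap_mk

theorem proj_add_single (y : Fin d → ℝ) (i : Fin d) (s : ℝ) :
    proj (y + s • Pi.single i 1) = proj y + Pi.single i (s : UnitAddCircle) := by
  funext j
  by_cases h : j = i
  · subst h
    simp [proj]
  · simp [proj, h]

theorem IsSmooth.continuous {f : FlatTorus d → ℝ} (hf : IsSmooth f) : Continuous f :=
  isOpenQuotientMap_proj.isQuotientMap.continuous_iff.2 (ContDiff.continuous hf)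

theorem IsSmooth.hasDerivAt_line {f : FlatTorus d → ℝ} (hf : IsSmooth f) (i : Fin d)
    (y : Fin d → ℝ) :
    HasDerivAt (fun s : ℝ => f (proj y + Pi.single i (s : UnitAddCircle)))
      (fderiv ℝ (fun z => f (proj z)) y (Pi.single i 1)) 0 := by
  have h1 : HasFDerivAt (fun z => f (proj z)) (fderiv ℝ (fun z => f (proj z)) y)
      (y + (0 : ℝ) • Pi.single i 1) := by
    simpa using ((ContDiff.differentiable hf (by simp)) y).hasFDerivAt
  have h2 : HasDerivAt (fun s : ℝ => y + s • (Pi.single i (1 : ℝ) : Fin d → ℝ))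
      (Pi.single i 1) 0 := by
    simpa using ((hasDerivAt_id (0 : ℝ)).smul_const (Pi.single i (1 : ℝ) : Fin d → ℝ)).const_add y
  simpa only [Function.comp_def, proj_add_single] using h1.comp_hasDerivAt (0 : ℝ) h2

theorem IsSmooth.partialDeriv_proj {f : FlatTorus d → ℝ} (hf : IsSmooth f) (i : Fin d)
    (y : Fin d → ℝ) :
    partialDeriv i f (proj y) = fderiv ℝ (fun z => f (proj z)) y (Pi.single i 1) :=
  (hf.hasDerivAt_line i y).deriv

theorem IsSmooth.hasDerivAt_partialDeriv {f : FlatTorus d → ℝ} (hf : IsSmooth f) (i : Fin d)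
    (x : FlatTorus d) (s₀ : ℝ) :
    HasDerivAt (fun s : ℝ => f (x + Pi.single i (s : UnitAddCircle)))
      (partialDeriv i f (x + Pi.single i (s₀ : UnitAddCircle))) s₀ := by
  obtain ⟨y, hy⟩ := isOpenQuotientMap_proj.surjective (x + Pi.single i (s₀ : UnitAddCircle))
  have h := hf.hasDerivAt_line i y
  rw [← hf.partialDeriv_proj, hy] at h
  have h2 := HasDerivAt.comp_sub_const s₀ s₀ (f := fun s : ℝ =>
    f (x + Pi.single i (s₀ : UnitAddCircle) + Pi.single i (s : UnitAddCircle))) (by simpa using h)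
  refine h2.congr_of_eventuallyEq (Eventually.of_forall fun s => ?_)
  simp only [add_assoc, ← Pi.single_add]
  congr 3
  rw [← AddCircle.coe_add]
  simp

theorem IsSmooth.partialDeriv {f : FlatTorus d → ℝ} (hf : IsSmooth f) (i : Fin d) :
    IsSmooth (partialDeriv i f) := by
  unfold IsSmooth
  simp only [hf.partialDeriv_proj]
  exact (ContDiff.fderiv_right hf (m := ∞) (by simp)).clm_apply contDiff_const

theorem IsSmooth.sub {f g : FlatTorus d → ℝ} (hf : IsSmooth f) (hg : IsSmooth g) :
    IsSmooth (fun x => f x - g x) :=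
  ContDiff.sub hf hg

/-- A smooth real function, as a complex-valued continuous map. -/
noncomputable def IsSmooth.toComplex {f : FlatTorus d → ℝ} (hf : IsSmooth f) : C(FlatTorus d, ℂ) :=
  ⟨fun x => (f x : ℂ), Complex.continuous_ofReal.comp hf.continuous⟩

/-- Translating a function multiplies its Fourier coefficients by a character. -/
theorem integral_mFourier_neg_mul_translate (f : FlatTorus d → ℂ) (k : Fin d → ℤ) (i : Fin d)
    (s : UnitAddCircle) :
    ∫ x, mFourier (-k) x * f (x + Pi.single i s) = fourier (k i) s * coeff f k := by
  have h := integral_add_right_eq_self (μ := (volume : Measure (FlatTorus d)))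
    (fun x => mFourier (-k) (x + Pi.single i (-s)) * f x) (Pi.single i s)
  have h0 : ∀ x : FlatTorus d, x + Pi.single i s + Pi.single i (-s) = x := fun x => by
    rw [add_assoc, ← Pi.single_add]; simp
  simp only [h0] at h
  rw [h, coeff, ← integral_const_mul]
  refine integral_congr_ae (Eventually.of_forall fun x => ?_)
  simp only [mFourier_add_single, Pi.neg_apply, mul_assoc]
  congr 1
  simp [fourier_apply]

theorem IsSmooth.coeff_partialDeriv {f : FlatTorus d → ℝ} (hf : IsSmooth f) (i : Fin d)
    (k : Fin d → ℤ) :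
    coeff (fun x => (FlatTorus.partialDeriv i f x : ℂ)) k
      = 2 * Real.pi * Complex.I * k i * coeff (fun x => (f x : ℂ)) k := by
  have hc := hf.continuous
  have hc' := (hf.partialDeriv i).continuous
  -- differentiate `∫ e^{-2πi k·x} f(x + s e_i) dx = e^{2πi k_i s} f̂(k)` in `s` at `s = 0`
  have hline : ∀ s : UnitAddCircle, Continuous fun x : FlatTorus d => x + Pi.single i s :=
    fun s => continuous_id.add continuous_const
  have h1 := hasDerivAt_integral_of_dominated_loc_of_deriv_le
    (μ := (volume : Measure (FlatTorus d))) (𝕜 := ℝ) (x₀ := 0) (s := univ)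
    (F := fun s x => mFourier (-k) x * (f (x + Pi.single i (s : UnitAddCircle)) : ℂ))
    (F' := fun s x => mFourier (-k) x *
      (FlatTorus.partialDeriv i f (x + Pi.single i (s : UnitAddCircle)) : ℂ))
    (bound := fun _ => ‖(hf.partialDeriv i).toComplex‖) univ_mem ?_ ?_ ?_ ?_ (integrable_const _) ?_
  · have h2 := h1.2
    simp only [AddCircle.coe_zero, Pi.single_zero, add_zero] at h2
    have h3 : HasDerivAt (fun s : ℝ => fourier (k i) (s : UnitAddCircle)
        * coeff (fun x => (f x : ℂ)) k)
        (2 * Real.pi * Complex.I * k i * coeff (fun x => (f x : ℂ)) k) 0 := by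
      simpa using (hasDerivAt_fourier 1 (k i) 0).mul_const (coeff (fun x => (f x : ℂ)) k)
    refine HasDerivAt.unique (h2.congr_of_eventuallyEq (Eventually.of_forall fun s => ?_)) h3
    exact (integral_mFourier_neg_mul_translate (fun x => (f x : ℂ)) k i s).symm
  · refine Eventually.of_forall fun s => Continuous.aestronglyMeasurable ?_
    exact (mFourier (-k)).continuous.mul
      (Complex.continuous_ofReal.comp (hc.comp (hline s)))
  · simp only [AddCircle.coe_zero, Pi.single_zero, add_zero]
    exact integrable_continuousMap volume (mFourier (-k) * hf.toComplex)
  · refine Continuous.aestronglyMeasurable ?_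
    exact (mFourier (-k)).continuous.mul
      (Complex.continuous_ofReal.comp (hc'.comp (hline _)))
  · refine Eventually.of_forall fun x s _ => ?_
    rw [norm_mul, norm_mFourier_apply, one_mul]
    exact (hf.partialDeriv i).toComplex.norm_coe_le_norm _
  · exact Eventually.of_forall fun x s _ =>
      ((hf.hasDerivAt_partialDeriv i x s).ofReal_comp).const_mul _

theorem coeff_sub {f g : C(FlatTorus d, ℂ)} (k : Fin d → ℤ) :
    coeff (fun x => f x - g x) k = coeff f k - coeff g k := by
  have := integral_sub (integrable_continuousMap volume (mFourier (-k) * f))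
    (integrable_continuousMap volume (mFourier (-k) * g))
  simpa only [coeff, ContinuousMap.mul_apply, ContinuousMap.sub_apply, mul_sub] using this

/-- Smooth functions have rapidly decaying Fourier coefficients: apply `1 - ∂_j²` once in each of
the directions in `s`. -/
theorem IsSmooth.exists_norm_coeff_mul_prod_le (s : Finset (Fin d)) :
    ∀ {f : FlatTorus d → ℝ}, IsSmooth f →
      ∃ C : ℝ, ∀ k,
        ‖coeff (fun x => (f x : ℂ)) k‖ * ∏ i ∈ s, (1 + (2 * Real.pi * k i) ^ 2) ≤ C := by
  induction s using Finset.induction_on with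
  | empty =>
    intro f hf
    refine ⟨‖hf.toComplex‖, fun k => ?_⟩
    rw [Finset.prod_empty, mul_one]
    exact norm_coeff_le hf.toComplex k
  | insert j s hj ih =>
    intro f hf
    have hff := (hf.partialDeriv j).partialDeriv j
    obtain ⟨C, hC⟩ := ih (hf.sub hff)
    refine ⟨C, fun k => ?_⟩
    have h1 : coeff (fun x =>
        ((f x - FlatTorus.partialDeriv j (FlatTorus.partialDeriv j f) x : ℝ) : ℂ)) k
        = ((1 + (2 * Real.pi * k j) ^ 2 : ℝ) : ℂ) * coeff (fun x => (f x : ℂ)) k := by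
      have h2 := coeff_sub (f := hf.toComplex) (g := hff.toComplex) k
      have h3 : coeff hff.toComplex k
          = -(2 * Real.pi * k j) ^ 2 * coeff (fun x => (f x : ℂ)) k := by
        have := (hf.partialDeriv j).coeff_partialDeriv j k
        rw [hf.coeff_partialDeriv j k] at this
        refine this.trans ?_
        linear_combination (2 * Real.pi * k j) ^ 2 * coeff (fun x => (f x : ℂ)) k * Complex.I_sq
      rw [h3] at h2
      push_cast
      refine h2.trans ?_
      have h4 : coeff hf.toComplex k = coeff (fun x => (f x : ℂ)) k := rfl
      rw [h4]
      ring
    have h5 := hC k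
    rw [h1, norm_mul, Complex.norm_real, Real.norm_of_nonneg (by positivity)] at h5
    rw [Finset.prod_insert hj]
    linarith

theorem summable_prod_apply {g : ℤ → ℝ} (hg0 : ∀ n, 0 ≤ g n) (hg : Summable g) :
    Summable fun k : Fin d → ℤ => ∏ i, g (k i) := by
  classical
  refine summable_of_sum_le (c := ∏ _i : Fin d, ∑' n, g n)
    (fun k => Finset.prod_nonneg fun i _ => hg0 _) fun u => ?_
  calc ∑ k ∈ u, ∏ i, g (k i)
      ≤ ∑ k ∈ Fintype.piFinset fun i => u.image fun k => k i, ∏ i, g (k i) := by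
        refine Finset.sum_le_sum_of_subset_of_nonneg (fun k hk => ?_)
          fun k _ _ => Finset.prod_nonneg fun i _ => hg0 _
        exact Fintype.mem_piFinset.2 fun i => Finset.mem_image_of_mem _ hk
    _ = ∏ i, ∑ n ∈ u.image fun k => k i, g n := (Finset.prod_univ_sum _ _).symm
    _ ≤ ∏ _i : Fin d, ∑' n, g n :=
        Finset.prod_le_prod (fun i _ => Finset.sum_nonneg fun n _ => hg0 n)
          fun i _ => hg.sum_le_tsum _ fun n _ => hg0 n

theorem summable_inv_one_add_sq_int : Summable fun n : ℤ => (1 + (n : ℝ) ^ 2)⁻¹ := by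
  refine Summable.of_norm_bounded_eventually (Real.summable_one_div_int_pow.2 one_lt_two) ?_
  filter_upwards [(finite_singleton (0 : ℤ)).compl_mem_cofinite] with n hn
  have hn : (n : ℝ) ≠ 0 := by exact_mod_cast hn
  rw [Real.norm_of_nonneg (by positivity), one_div]
  gcongr
  linarith

theorem IsSmooth.summable_norm_coeff {f : FlatTorus d → ℝ} (hf : IsSmooth f) :
    Summable fun k => ‖coeff (fun x => (f x : ℂ)) k‖ := by
  obtain ⟨C, hC⟩ := hf.exists_norm_coeff_mul_prod_le Finset.univ
  have hs := (summable_prod_apply (d := d) (fun n => by positivity)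
    summable_inv_one_add_sq_int).mul_left C
  refine Summable.of_nonneg_of_le (fun _ => norm_nonneg _) (fun k => ?_) hs
  rw [Finset.prod_inv_distrib, ← div_eq_mul_inv, le_div_iff₀ (by positivity)]
  refine le_trans ?_ (hC k)
  have hpi := Real.pi_gt_three
  have hle : ∀ i, 1 + (k i : ℝ) ^ 2 ≤ 1 + (2 * Real.pi * k i) ^ 2 := fun i => by
    have h1 : 1 ≤ (2 * Real.pi) ^ 2 := one_le_pow₀ (by linarith)
    rw [mul_pow]
    linarith [mul_le_mul_of_nonneg_right h1 (sq_nonneg (k i : ℝ))]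
  exact mul_le_mul_of_nonneg_left
    (Finset.prod_le_prod (fun i _ => by positivity) fun i _ => hle i) (norm_nonneg _)

/-- `|k|²`, the squared Euclidean length of a frequency. -/
def normSq (k : Fin d → ℤ) : ℝ := ∑ i, (k i : ℝ) ^ 2

theorem IsSmooth.laplace {f : FlatTorus d → ℝ} (hf : IsSmooth f) : IsSmooth (laplace f) := by
  unfold IsSmooth FlatTorus.laplace
  exact ContDiff.sum fun i _ => (hf.partialDeriv i).partialDeriv i

/-- The Fourier series of a smooth function converges absolutely to it. -/
theorem IsSmooth.hasSum_coeff {f : FlatTorus d → ℝ} (hf : IsSmooth f) (x : FlatTorus d) :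
    HasSum (fun k => coeff (fun x => (f x : ℂ)) k * mFourier k x) (f x : ℂ) :=
  hasSum_coeff_mul_mFourier (f := hf.toComplex) hf.summable_norm_coeff x

theorem IsSmooth.coeff_laplace {f : FlatTorus d → ℝ} (hf : IsSmooth f) (k : Fin d → ℤ) :
    coeff (fun x => (FlatTorus.laplace f x : ℂ)) k
      = -(4 * Real.pi ^ 2 * normSq k : ℝ) * coeff (fun x => (f x : ℂ)) k := by
  have h1 : coeff (fun x => (FlatTorus.laplace f x : ℂ)) k
      = ∑ i, coeff (fun x => (FlatTorus.partialDeriv i (FlatTorus.partialDeriv i f) x : ℂ)) k := by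
    simp only [coeff, FlatTorus.laplace, Complex.ofReal_sum, Finset.mul_sum]
    exact integral_finsetSum _ fun i _ => integrable_continuousMap volume
      (mFourier (-k) * ((hf.partialDeriv i).partialDeriv i).toComplex)
  rw [h1]
  simp_rw [fun i => (hf.partialDeriv i).coeff_partialDeriv i k, hf.coeff_partialDeriv, normSq]
  push_cast
  rw [Finset.mul_sum, ← Finset.sum_neg_distrib, Finset.sum_mul]
  refine Finset.sum_congr rfl fun i _ => ?_
  linear_combination (2 * Real.pi * k i) ^ 2 * coeff (fun x => (f x : ℂ)) k * Complex.I_sq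

/-! ### Shear flows and their action on Fourier coefficients -/

/-- The pairing `k · w` of a frequency with a vector. -/
def pairing (k : Fin d → ℤ) (w : Fin d → ℝ) : ℝ := ∑ i, (k i : ℝ) * w i

/-- The time-modulated shear flow `u(t,x) = ρ(t) sin(2π m·x) w`, divergence-free if `m · w = 0`. -/
noncomputable def shear (ρ : ℝ → ℝ) (w : Fin d → ℝ) (m : Fin d → ℤ) :
    ℝ → FlatTorus d → Fin d → ℝ :=
  fun t x i => ρ t * (mFourier m x).im * w i

theorem partialDeriv_clm_mFourier (L : ℂ →L[ℝ] ℝ) (c : ℂ) (k : Fin d → ℤ) (i : Fin d) :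
    partialDeriv i (fun x => L (c * mFourier k x))
      = fun x => L (c * (2 * Real.pi * Complex.I * k i) * mFourier k x) := by
  funext x
  have := (L.hasFDerivAt.comp_hasDerivAt (0 : ℝ)
    ((hasDerivAt_mFourier_line k x i).const_mul c)).deriv
  rw [partialDeriv, mul_assoc]
  exact this

theorem contDiff_mFourier_proj (k : Fin d → ℤ) :
    ContDiff ℝ ∞ (fun y : Fin d → ℝ => mFourier k (proj y)) := by
  simp only [mFourier_proj]
  refine ContDiff.cexp (ContDiff.mul (Complex.ofRealCLM.contDiff.comp
    (contDiff_const.mul (ContDiff.sum fun j _ => ?_))) contDiff_const)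
  exact contDiff_const.mul (contDiff_apply ℝ ℝ j)

theorem isSmooth_clm_mFourier (L : ℂ →L[ℝ] ℝ) (k : Fin d → ℤ) :
    IsSmooth (fun x : FlatTorus d => L (mFourier k x)) :=
  L.contDiff.comp (contDiff_mFourier_proj k)

theorem isSmoothField_shear {ρ : ℝ → ℝ} (hρ : ContDiff ℝ ∞ ρ) (w : Fin d → ℝ) (m : Fin d → ℤ) :
    IsSmoothField (shear ρ w m) := by
  refine ContDiff.contDiffOn (contDiff_pi.2 fun i => ?_)
  exact ((hρ.comp contDiff_fst).mul
    ((isSmooth_clm_mFourier Complex.imCLM m).comp contDiff_snd)).mul contDiff_const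

theorem divergence_shear (ρ : ℝ → ℝ) {w : Fin d → ℝ} {m : Fin d → ℤ} (h : pairing m w = 0)
    (t : ℝ) (x : FlatTorus d) : divergence (shear ρ w m t) x = 0 := by
  have h1 : ∀ i, partialDeriv i (fun y => shear ρ w m t y i) x
      = ρ t * (2 * Real.pi * (mFourier m x).re) * (m i * w i) := by
    intro i
    have := congrFun (partialDeriv_clm_mFourier ((ρ t * w i) • Complex.imCLM) 1 m i) x
    have e : (fun x => ((ρ t * w i) • Complex.imCLM) (1 * mFourier m x))
        = fun y => shear ρ w m t y i := by
      funext y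
      simp only [one_mul, shear, _root_.smul_apply, Complex.imCLM_apply, smul_eq_mul]
      ring
    rw [e] at this
    rw [this]
    simp
    ring
  simp only [divergence, h1, ← Finset.mul_sum]
  rw [show ∑ i, (m i : ℝ) * w i = 0 from h, mul_zero]

/-- The image of the character `e_k` under the adjoint generator `Δ + u · ∇`, for the shear flow
`u = r sin(2π m·x) w` at a fixed time; it only involves the frequencies `k` and `k ± m`. -/
noncomputable def genChar (r : ℝ) (w : Fin d → ℝ) (m k : Fin d → ℤ) : C(FlatTorus d, ℂ) :=
  (-(4 * Real.pi ^ 2 * normSq k)) • mFourier k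
    + (Real.pi * r * pairing k w) • (mFourier (k + m) - mFourier (k - m))

theorem genChar_apply (r : ℝ) (w : Fin d → ℝ) (m k : Fin d → ℤ) (x : FlatTorus d) :
    genChar r w m k x = (-(4 * Real.pi ^ 2 * normSq k) : ℝ) * mFourier k x
      + ∑ i, (r * (mFourier m x).im * w i : ℝ) * (2 * Real.pi * Complex.I * k i)
        * mFourier k x := by
  have h1 : mFourier (k - m) x = mFourier k x * (starRingEnd ℂ) (mFourier m x) := by
    rw [sub_eq_add_neg, mFourier_add, mFourier_neg]
  have h2 : mFourier m x - (starRingEnd ℂ) (mFourier m x) = 2 * (mFourier m x).im * Complex.I := by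
    rw [Complex.sub_conj]; push_cast; ring
  simp only [genChar, ContinuousMap.add_apply, ContinuousMap.smul_apply, ContinuousMap.sub_apply,
    Complex.real_smul, h1, mFourier_add]
  congr 1
  have h3 : ∑ i, ((r * (mFourier m x).im * w i : ℝ) : ℂ) * (2 * Real.pi * Complex.I * k i)
      * mFourier k x = r * (mFourier m x).im * (2 * Real.pi * Complex.I) * mFourier k x
        * (pairing k w : ℝ) := by
    simp only [pairing, Complex.ofReal_sum, Finset.mul_sum]
    refine Finset.sum_congr rfl fun i _ => ?_
    push_cast
    ring
  rw [h3]
  push_cast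
  linear_combination (Real.pi * r * pairing k w : ℂ) * mFourier k x * h2

theorem generator_clm_mFourier (L : ℂ →L[ℝ] ℝ) (ρ : ℝ → ℝ) (w : Fin d → ℝ) (m k : Fin d → ℤ)
    (t : ℝ) (x : FlatTorus d) :
    laplace (fun x => L (mFourier k x)) x
      + ∑ i, shear ρ w m t x i * partialDeriv i (fun x => L (mFourier k x)) x
      = L (genChar (ρ t) w m k x) := by
  have h1 : ∀ i, partialDeriv i (fun x => L (mFourier k x))
      = fun x => L (2 * Real.pi * Complex.I * k i * mFourier k x) := fun i => by
    simpa using partialDeriv_clm_mFourier L 1 k i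
  simp only [laplace, h1, partialDeriv_clm_mFourier, genChar_apply, map_add, map_sum, shear]
  congr 1
  · rw [← map_sum]
    congr 1
    simp only [normSq]
    push_cast
    rw [Finset.mul_sum, ← Finset.sum_neg_distrib, Finset.sum_mul]
    refine Finset.sum_congr rfl fun i _ => ?_
    linear_combination (2 * Real.pi * k i) ^ 2 * mFourier k x * Complex.I_sq
  · refine Finset.sum_congr rfl fun i _ => ?_
    rw [← smul_eq_mul (ρ t * _ * _), ← map_smul, Complex.real_smul, mul_assoc (Complex.ofReal _)]

theorem integral_genChar (r : ℝ) (w : Fin d → ℝ) (m k : Fin d → ℤ)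
    (μ : Measure (FlatTorus d)) [IsFiniteMeasure μ] :
    ∫ x, genChar r w m k x ∂μ = (-(4 * Real.pi ^ 2 * normSq k)) • ∫ x, mFourier k x ∂μ
      + (Real.pi * r * pairing k w) •
        (∫ x, mFourier (k + m) x ∂μ - ∫ x, mFourier (k - m) x ∂μ) := by
  have i1 : Integrable (fun x => (-(4 * Real.pi ^ 2 * normSq k)) • mFourier k x) μ :=
    (integrable_continuousMap μ (mFourier k)).smul (-(4 * Real.pi ^ 2 * normSq k))
  have i2 := integrable_continuousMap μ (mFourier (k + m))
  have i3 := integrable_continuousMap μ (mFourier (k - m))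
  simp only [genChar, ContinuousMap.add_apply, ContinuousMap.smul_apply, ContinuousMap.sub_apply]
  have i4 : Integrable (fun x => (Real.pi * r * pairing k w) •
    (mFourier (k + m) x - mFourier (k - m) x)) μ :=
    (i2.sub i3).smul (Real.pi * r * pairing k w)
  rw [integral_add i1 i4, integral_smul, integral_smul, integral_sub i2 i3]

/-- The linear system satisfied by the Fourier coefficients of a solution with shear drift. It is
real, so it holds separately for their real and imaginary parts. -/
def CoeffODE (ρ : ℝ → ℝ) (w : Fin d → ℝ) (m : Fin d → ℤ) (c : (Fin d → ℤ) → ℝ → ℝ) : Prop :=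
  ∀ k t, 0 < t → HasDerivAt (c k) (-(4 * Real.pi ^ 2 * normSq k) * c k t
    + Real.pi * ρ t * pairing k w * (c (k + m) t - c (k - m) t)) t

theorem IsSolution.coeffODE {ρ : ℝ → ℝ} {w : Fin d → ℝ} {m : Fin d → ℤ}
    {μ : FiniteMeasure (FlatTorus d)} {θ : ℝ → FiniteMeasure (FlatTorus d)}
    (h : IsSolution (shear ρ w m) μ θ) (L : ℂ →L[ℝ] ℝ) :
    CoeffODE ρ w m fun k t => L (∫ x, mFourier k x ∂(θ t : Measure (FlatTorus d))) := by
  intro k t ht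
  have h1 := h.equation _ (isSmooth_clm_mFourier L k) t ht
  simp only [generator_clm_mFourier] at h1
  rw [L.integral_comp_comm (integrable_continuousMap _ (genChar (ρ t) w m k)),
    integral_genChar] at h1
  simp only [fun s => L.integral_comp_comm (integrable_continuousMap (θ s : Measure (FlatTorus d))
    (mFourier k)), map_add, map_smul, map_sub, smul_eq_mul] at h1
  exact h1

theorem IsSolution.continuousOn_coeff {u : ℝ → FlatTorus d → Fin d → ℝ}
    {μ : FiniteMeasure (FlatTorus d)} {θ : ℝ → FiniteMeasure (FlatTorus d)}
    (h : IsSolution u μ θ) (L : ℂ →L[ℝ] ℝ) (k : Fin d → ℤ) :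
    ContinuousOn (fun t => L (∫ x, mFourier k x ∂(θ t : Measure (FlatTorus d)))) (Ici 0) := by
  intro t ht
  have h1 := (FiniteMeasure.tendsto_iff_forall_integral_rclike_tendsto ℂ).1 (h.continuousOn t ht)
    (BoundedContinuousFunction.mkOfCompact (mFourier k))
  exact (L.continuous.tendsto _).comp h1

/-- Termwise expansion of `(Δ + u·∇)ψ` for smooth `ψ`, with a summable bound that is uniform
over shears of amplitude at most `R`. -/
theorem IsSmooth.hasSum_generator {ψ : FlatTorus d → ℝ} (hψ : IsSmooth ψ) (w : Fin d → ℝ)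
    (m : Fin d → ℤ) (R : ℝ) :
    ∃ b : (Fin d → ℤ) → ℝ, Summable b ∧
      (∀ r, |r| ≤ R → ∀ k, ‖coeff (fun x => (ψ x : ℂ)) k • genChar r w m k‖ ≤ b k) ∧
      ∀ r x, HasSum (fun k => (coeff (fun x => (ψ x : ℂ)) k • genChar r w m k) x)
        ((FlatTorus.laplace ψ x + ∑ i, r * (mFourier m x).im * w i
          * FlatTorus.partialDeriv i ψ x : ℝ) : ℂ) := by
  set a := coeff (fun x => (ψ x : ℂ)) with ha
  refine ⟨fun k => ‖coeff (fun x => (FlatTorus.laplace ψ x : ℂ)) k‖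
    + ∑ i, R * |w i| * ‖coeff (fun x => (FlatTorus.partialDeriv i ψ x : ℂ)) k‖,
    hψ.laplace.summable_norm_coeff.add (summable_sum fun i _ =>
      (hψ.partialDeriv i).summable_norm_coeff.mul_left _), ?_, ?_⟩
  · intro r hr k
    rw [ContinuousMap.norm_le _ (by positivity [(abs_nonneg r).trans hr])]
    intro x
    rw [ContinuousMap.smul_apply, genChar_apply, smul_eq_mul, mul_add, Finset.mul_sum]
    refine (norm_add_le _ _).trans (add_le_add ?_ ((norm_sum_le _ _).trans
      (Finset.sum_le_sum fun i _ => ?_)))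
    · rw [hψ.coeff_laplace, norm_mul, norm_mul, norm_mul, norm_mFourier_apply, norm_neg]
      simp only [Complex.ofReal_neg, norm_neg]
      rw [mul_one, mul_comm]
    · rw [hψ.coeff_partialDeriv]
      simp only [norm_mul, norm_mFourier_apply, Complex.norm_real, Real.norm_eq_abs, mul_one]
      have h1 : |(mFourier m x).im| ≤ 1 :=
        (Complex.abs_im_le_norm _).trans (norm_mFourier_apply m x).le
      have h2 : |r| * |(mFourier m x).im| ≤ R := by
        calc _ ≤ R * 1 := by gcongr; exact (abs_nonneg r).trans hr
          _ = R := mul_one R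
      rw [mul_comm ‖a k‖, mul_assoc, mul_assoc R, mul_assoc (|r| * _)]
      gcongr
  · intro r x
    have h1 := hψ.laplace.hasSum_coeff x
    have h2 := hasSum_sum (s := Finset.univ) fun i _ =>
      ((hψ.partialDeriv i).hasSum_coeff x).mul_left ((r * (mFourier m x).im * w i : ℝ) : ℂ)
    convert h1.add h2 using 1
    · funext k
      rw [ContinuousMap.smul_apply, genChar_apply, smul_eq_mul, mul_add, Finset.mul_sum,
        hψ.coeff_laplace]
      congr 1
      · push_cast; ring
      · refine Finset.sum_congr rfl fun i _ => ?_
        rw [hψ.coeff_partialDeriv]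
        ring
    · push_cast
      rfl

/-- A family of probability measures whose Fourier coefficients are real and solve the linear
system is a solution of the advection-diffusion equation. -/
theorem isSolution_shear_of_coeffODE {ρ : ℝ → ℝ} {w : Fin d → ℝ} {m : Fin d → ℤ} {R : ℝ}
    (hρ : ∀ t, |ρ t| ≤ R) {c : (Fin d → ℤ) → ℝ → ℝ} (hode : CoeffODE ρ w m c)
    (hcont : ∀ k, ContinuousOn (c k) (Ici 0)) (hc0 : ∀ t, 0 ≤ t → c 0 t = 1)
    {θ : ℝ → FiniteMeasure (FlatTorus d)}
    (hθ : ∀ t, 0 ≤ t → ∀ k, ∫ x, mFourier k x ∂(θ t : Measure (FlatTorus d)) = c k t) :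
    IsSolution (shear ρ w m) (θ 0) θ := by
  refine ⟨?_, rfl, ?_⟩
  · intro t ht
    refine tendsto_of_tendsto_integral_mFourier fun k => ?_
    have h1 : Tendsto (fun s => (c k s : ℂ)) (𝓝[Ici 0] t) (𝓝 (c k t)) :=
      (Complex.continuous_ofReal.tendsto _).comp (hcont k t ht)
    rw [hθ t ht k]
    refine h1.congr' ?_
    filter_upwards [self_mem_nhdsWithin] with s hs
    exact (hθ s hs k).symm
  intro ψ hψ t ht
  obtain ⟨b, hb, hbound, hsum⟩ := hψ.hasSum_generator w m R
  set a := coeff (fun x => (ψ x : ℂ)) with ha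
  have hmass : ∀ t, 0 ≤ t → ((θ t).mass : ℝ) = 1 := fun t ht => by
    have := hθ t ht 0
    rw [integral_mFourier_zero, hc0 t ht] at this
    exact_mod_cast this
  have hgen : ∀ s, 0 ≤ s → ∀ k, ∫ x, genChar (ρ s) w m k x ∂(θ s : Measure (FlatTorus d))
      = ((-(4 * Real.pi ^ 2 * normSq k) * c k s
        + Real.pi * ρ s * pairing k w * (c (k + m) s - c (k - m) s) : ℝ) : ℂ) := by
    intro s hs k
    rw [integral_genChar, hθ s hs, hθ s hs, hθ s hs]
    simp only [Complex.real_smul]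
    push_cast
    ring
  have hval : ∀ s, 0 ≤ s → HasSum (fun k => a k * (c k s : ℂ))
      ((∫ x, ψ x ∂(θ s : Measure (FlatTorus d)) : ℝ) : ℂ) := by
    intro s hs
    have := hasSum_integral_of_bound (θ s : Measure (FlatTorus d))
      (g := fun k => a k • mFourier k) (G := fun x => (ψ x : ℂ)) hψ.summable_norm_coeff
      (fun k => by rw [norm_smul, mFourier_norm, mul_one]) (fun x => hψ.hasSum_coeff x)
    simp only [ContinuousMap.smul_apply, smul_eq_mul, integral_const_mul, hθ s hs] at this
    have h2 : ∫ x, (ψ x : ℂ) ∂(θ s : Measure (FlatTorus d))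
      = ((∫ x, ψ x ∂(θ s : Measure (FlatTorus d)) : ℝ) : ℂ) := integral_ofReal
    rwa [h2] at this
  have hder := hasDerivAt_tsum_of_isPreconnected (𝕜 := ℝ) hb isOpen_Ioi isPreconnected_Ioi
    (t := Ioi (0 : ℝ)) (g := fun k s => a k * (c k s : ℂ))
    (g' := fun k s => a k * ((-(4 * Real.pi ^ 2 * normSq k) * c k s
        + Real.pi * ρ s * pairing k w * (c (k + m) s - c (k - m) s) : ℝ) : ℂ))
    (fun k s hs => ((hode k s hs).ofReal_comp).const_mul _) ?_ (y₀ := t) (y := t) ht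
    (hval t ht.le).summable ht
  · have h3 := hasSum_integral_of_bound (θ t : Measure (FlatTorus d)) hb (hbound (ρ t) (hρ t))
      (hsum (ρ t))
    simp only [ContinuousMap.smul_apply, smul_eq_mul, integral_const_mul, hgen t ht.le] at h3
    rw [h3.tsum_eq] at hder
    have h4 : ∫ x, ((FlatTorus.laplace ψ x + ∑ i, ρ t * (mFourier m x).im * w i
          * FlatTorus.partialDeriv i ψ x : ℝ) : ℂ) ∂(θ t : Measure (FlatTorus d))
        = ((∫ x, (FlatTorus.laplace ψ x + ∑ i, ρ t * (mFourier m x).im * w i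
          * FlatTorus.partialDeriv i ψ x) ∂(θ t : Measure (FlatTorus d)) : ℝ) : ℂ) :=
      integral_ofReal
    rw [h4] at hder
    have h5 := Complex.reCLM.hasFDerivAt.comp_hasDerivAt t hder
    refine HasDerivAt.congr_of_eventuallyEq h5 ?_
    filter_upwards [Ioi_mem_nhds ht] with s hs
    simp [(hval s (le_of_lt hs)).tsum_eq]
  · intro k s hs
    rw [← hgen s (le_of_lt hs) k]
    have h6 := norm_integral_le_mass (θ s) (a k • genChar (ρ s) w m k)
    simp only [ContinuousMap.smul_apply, smul_eq_mul, integral_const_mul,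
      hmass s (le_of_lt hs), mul_one] at h6
    exact h6.trans (hbound _ (hρ s) k)

/-! ### The linear system for the Fourier coefficients -/

/-- The upper half of `abs_le_of_relaxation`: `e^{at} (z - M)` is nonincreasing. -/
theorem le_of_relaxation {a M : ℝ} (hM : 0 ≤ M) {z g : ℝ → ℝ} (hz : ContinuousOn z (Ici 0))
    (h0 : z 0 = 0) (hd : ∀ t, 0 < t → HasDerivAt z (-a * z t + g t) t)
    (hg : ∀ t, 0 < t → g t ≤ a * M) {t : ℝ} (ht : 0 ≤ t) : z t ≤ M := by
  have hder : ∀ t, 0 < t → HasDerivAt (fun t => Real.exp (a * t) * (z t - M))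
      (Real.exp (a * t) * (g t - a * M)) t := by
    intro t ht
    have h1 : HasDerivAt (fun t => Real.exp (a * t)) (Real.exp (a * t) * a) t := by
      simpa using ((hasDerivAt_id t).const_mul a).exp
    exact (h1.mul ((hd t ht).sub_const M)).congr_deriv (by ring)
  have hanti : AntitoneOn (fun t => Real.exp (a * t) * (z t - M)) (Ici 0) := by
    refine antitoneOn_of_deriv_nonpos (convex_Ici 0) ?_ ?_ ?_
    · exact (by fun_prop : Continuous fun t => Real.exp (a * t)).continuousOn.mul
        (hz.sub continuousOn_const)
    · intro t ht
      rw [interior_Ici] at ht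
      exact (hder t ht).differentiableAt.differentiableWithinAt
    · intro t ht
      rw [interior_Ici] at ht
      rw [(hder t ht).deriv]
      exact mul_nonpos_of_nonneg_of_nonpos (Real.exp_pos _).le (by linarith [hg t ht])
  have h1 := hanti self_mem_Ici ht ht
  simp only [mul_zero, Real.exp_zero, h0, one_mul] at h1
  have h2 : Real.exp (a * t) * (z t - M) ≤ 0 := by linarith
  have h3 := nonpos_of_mul_nonpos_right h2 (Real.exp_pos _)
  linarith

/-- A solution of `z' = -a z + g`, `z(0) = 0`, is bounded by `M` if `|g| ≤ a M`. The case `a = 0`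
is included: then `g = 0` and `z` is constant. -/
theorem abs_le_of_relaxation {a M : ℝ} (hM : 0 ≤ M) {z g : ℝ → ℝ} (hz : ContinuousOn z (Ici 0))
    (h0 : z 0 = 0) (hd : ∀ t, 0 < t → HasDerivAt z (-a * z t + g t) t)
    (hg : ∀ t, 0 < t → |g t| ≤ a * M) {t : ℝ} (ht : 0 ≤ t) : |z t| ≤ M := by
  refine abs_le.2 ⟨?_, le_of_relaxation hM hz h0 hd (fun t ht => (abs_le.1 (hg t ht)).2) ht⟩
  have := le_of_relaxation (z := fun t => -z t) (g := fun t => -g t) (a := a) hM hz.neg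
    (by simp [h0]) (fun t ht => (hd t ht).neg.congr_deriv (by ring))
    (fun t ht => by linarith [(abs_le.1 (hg t ht)).1]) ht
  linarith

/-- `|k|₁`, the sum of the absolute values of the entries of a frequency. -/
def absSum (k : Fin d → ℤ) : ℝ := ∑ i, |(k i : ℝ)|

/-- `|w|₁`, the sum of the absolute values of the entries of a vector. -/
def vecSum (w : Fin d → ℝ) : ℝ := ∑ i, |w i|

theorem vecSum_nonneg (w : Fin d → ℝ) : 0 ≤ vecSum w := Finset.sum_nonneg fun _ _ => abs_nonneg _

theorem absSum_nonneg (k : Fin d → ℤ) : 0 ≤ absSum k := Finset.sum_nonneg fun _ _ => abs_nonneg _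

theorem normSq_nonneg (k : Fin d → ℤ) : 0 ≤ normSq k := Finset.sum_nonneg fun _ _ => sq_nonneg _

theorem abs_le_sq_int (n : ℤ) : |(n : ℝ)| ≤ (n : ℝ) ^ 2 := by
  rw [← Int.cast_abs, ← Int.cast_pow]
  exact_mod_cast (Int.le_self_sq |n|).trans_eq (sq_abs n)

theorem absSum_le_normSq (k : Fin d → ℤ) : absSum k ≤ normSq k :=
  Finset.sum_le_sum fun i _ => abs_le_sq_int (k i)

theorem abs_pairing_le (k : Fin d → ℤ) (w : Fin d → ℝ) :
    |pairing k w| ≤ vecSum w * normSq k := by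
  rw [pairing, vecSum, Finset.sum_mul]
  refine (Finset.abs_sum_le_sum_abs _ _).trans (Finset.sum_le_sum fun i _ => ?_)
  rw [abs_mul, mul_comm]
  gcongr
  exact (abs_le_sq_int (k i)).trans (Finset.single_le_sum (f := fun i => (k i : ℝ) ^ 2)
    (fun _ _ => sq_nonneg _) (Finset.mem_univ i))

theorem absSum_neg (k : Fin d → ℤ) : absSum (-k) = absSum k := by simp [absSum]

theorem normSq_neg (k : Fin d → ℤ) : normSq (-k) = normSq k := by simp [normSq]

theorem pairing_neg (k : Fin d → ℤ) (w : Fin d → ℝ) : pairing (-k) w = -pairing k w := by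
  simp [pairing]

theorem absSum_le_add (k m : Fin d → ℤ) : absSum k ≤ absSum (k + m) + absSum m := by
  rw [absSum, absSum, absSum, ← Finset.sum_add_distrib]
  refine Finset.sum_le_sum fun i _ => ?_
  have h := abs_sub ((k i : ℝ) + m i) (m i)
  simpa using h

theorem absSum_le_sub (k m : Fin d → ℤ) : absSum k ≤ absSum (k - m) + absSum m := by
  have := absSum_le_add k (-m)
  rwa [absSum_neg, ← sub_eq_add_neg] at this

/-- `λ_k = 4π²|k|²`, the eigenvalue of `-Δ` on the character of frequency `k`. -/
noncomputable def eigenvalue (k : Fin d → ℤ) : ℝ := 4 * Real.pi ^ 2 * normSq k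

theorem absSum_le_eigenvalue (k : Fin d → ℤ) : absSum k ≤ eigenvalue k := by
  refine (absSum_le_normSq k).trans (le_mul_of_one_le_left (normSq_nonneg k) ?_)
  nlinarith [Real.pi_gt_three]

theorem eigenvalue_nonneg (k : Fin d → ℤ) : 0 ≤ eigenvalue k :=
  (absSum_nonneg k).trans (absSum_le_eigenvalue k)

/-- The term of the linear system that couples the frequency `k` to `k ± m`. -/
noncomputable def coupling (ρ : ℝ → ℝ) (w : Fin d → ℝ) (m : Fin d → ℤ)
    (c : (Fin d → ℤ) → ℝ → ℝ) (k : Fin d → ℤ) (t : ℝ) : ℝ :=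
  Real.pi * ρ t * pairing k w * (c (k + m) t - c (k - m) t)

theorem coeffODE_iff {ρ : ℝ → ℝ} {w : Fin d → ℝ} {m : Fin d → ℤ} {c : (Fin d → ℤ) → ℝ → ℝ} :
    CoeffODE ρ w m c ↔ ∀ k t, 0 < t →
      HasDerivAt (c k) (-eigenvalue k * c k t + coupling ρ w m c k t) t := Iff.rfl

/-- The dissipation dominates the coupling: the factor `|k · w| ≲ |k|²` is absorbed by `λ_k`. -/
theorem abs_coupling_le {ρ : ℝ → ℝ} {ε : ℝ} {w : Fin d → ℝ} {m : Fin d → ℤ}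
    {c : (Fin d → ℤ) → ℝ → ℝ} {k : Fin d → ℤ} {t N : ℝ} (hρ : |ρ t| ≤ ε)
    (h1 : |c (k + m) t| ≤ N) (h2 : |c (k - m) t| ≤ N) :
    |coupling ρ w m c k t| ≤ eigenvalue k * (ε * vecSum w / 2 * N) := by
  have hN : 0 ≤ N := (abs_nonneg _).trans h1
  have hε : 0 ≤ ε := (abs_nonneg _).trans hρ
  have hW := vecSum_nonneg w
  have hk := normSq_nonneg k
  have h3 : |c (k + m) t - c (k - m) t| ≤ 2 * N := (abs_sub _ _).trans (by linarith)
  have hpi := Real.pi_gt_three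
  calc |coupling ρ w m c k t|
      = Real.pi * |ρ t| * |pairing k w| * |c (k + m) t - c (k - m) t| := by
        rw [coupling, abs_mul, abs_mul, abs_mul, abs_of_pos Real.pi_pos]
    _ ≤ Real.pi * ε * (vecSum w * normSq k) * (2 * N) := by
        gcongr
        exact abs_pairing_le k w
    _ = Real.pi * (2 * (ε * vecSum w * N * normSq k)) := by ring
    _ ≤ Real.pi * (Real.pi * (2 * (ε * vecSum w * N * normSq k))) := by
        refine mul_le_mul_of_nonneg_left (le_mul_of_one_le_left (by positivity) ?_) Real.pi_pos.le
        linarith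
    _ = eigenvalue k * (ε * vecSum w / 2 * N) := by rw [eigenvalue]; ring

/-- Bounded solutions of the linear system with a weak shear are determined by their initial
values: by dissipation, a bound on a difference of two solutions improves itself by a factor. -/
theorem CoeffODE.unique {ρ : ℝ → ℝ} {ε B : ℝ} {w : Fin d → ℝ} {m : Fin d → ℤ}
    (hρ : ∀ t, |ρ t| ≤ ε) (hε : ε * vecSum w ≤ 1)
    {c c' : (Fin d → ℤ) → ℝ → ℝ} (hc : CoeffODE ρ w m c) (hc' : CoeffODE ρ w m c')
    (hcc : ∀ k, ContinuousOn (c k) (Ici 0)) (hcc' : ∀ k, ContinuousOn (c' k) (Ici 0))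
    (hb : ∀ k t, 0 ≤ t → |c k t| ≤ B) (hb' : ∀ k t, 0 ≤ t → |c' k t| ≤ B)
    (h0 : ∀ k, c k 0 = c' k 0) (k : Fin d → ℤ) {t : ℝ} (ht : 0 ≤ t) : c k t = c' k t := by
  have key : ∀ n : ℕ, ∀ k, ∀ t, 0 ≤ t → |c k t - c' k t| ≤ 2 * B * (1 / 2) ^ n := by
    intro n
    induction n with
    | zero =>
      intro k t ht
      rw [pow_zero, mul_one]
      linarith [abs_sub (c k t) (c' k t), hb k t ht, hb' k t ht]
    | succ n ih =>
      intro k t ht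
      have hN : 0 ≤ 2 * B * (1 / 2) ^ n := (abs_nonneg _).trans (ih k t ht)
      refine abs_le_of_relaxation (a := eigenvalue k) (z := fun t => c k t - c' k t)
        (g := coupling ρ w m (fun k t => c k t - c' k t) k) ?_ ((hcc k).sub (hcc' k))
        (by simp [h0 k]) ?_ ?_ ht
      · rw [pow_succ]; linarith
      · intro s hs
        refine ((coeffODE_iff.1 hc k s hs).sub (coeffODE_iff.1 hc' k s hs)).congr_deriv ?_
        simp only [coupling]
        ring
      · intro s hs
        refine (abs_coupling_le (hρ s) (ih _ s hs.le) (ih _ s hs.le)).trans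
          (mul_le_mul_of_nonneg_left ?_ (eigenvalue_nonneg k))
        rw [pow_succ]
        have := mul_le_mul_of_nonneg_right hε hN
        linarith
  have hlim : Tendsto (fun n : ℕ => 2 * B * (1 / 2 : ℝ) ^ n) atTop (𝓝 0) := by
    simpa using (tendsto_pow_atTop_nhds_zero_of_lt_one (by norm_num : (0 : ℝ) ≤ 1 / 2)
      (by norm_num)).const_mul (2 * B)
  have := ge_of_tendsto' hlim fun n => key n k t ht
  exact sub_eq_zero.1 (abs_nonpos_iff.1 this)

/-- The solution of `z' = -a z + g`, `z(0) = 0`. -/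
noncomputable def duhamel (a : ℝ) (g : ℝ → ℝ) (t : ℝ) : ℝ :=
  Real.exp (-a * t) * ∫ s in (0 : ℝ)..t, Real.exp (a * s) * g s

theorem hasDerivAt_duhamel (a : ℝ) {g : ℝ → ℝ} (hg : Continuous g) (t : ℝ) :
    HasDerivAt (duhamel a g) (-a * duhamel a g t + g t) t := by
  have hc : Continuous fun s => Real.exp (a * s) * g s := by fun_prop
  have h1 : HasDerivAt (fun t => Real.exp (-a * t)) (Real.exp (-a * t) * -a) t := by
    simpa using ((hasDerivAt_id t).const_mul (-a)).exp
  have h2 := hc.integral_hasStrictDerivAt 0 t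
  have h3 : Real.exp (-a * t) * Real.exp (a * t) = 1 := by rw [← Real.exp_add]; simp
  refine (h1.mul h2.hasDerivAt).congr_deriv ?_
  rw [duhamel]
  linear_combination g t * h3

theorem duhamel_sub (a : ℝ) {g g' : ℝ → ℝ} (hg : Continuous g) (hg' : Continuous g') (t : ℝ) :
    duhamel a (fun s => g s - g' s) t = duhamel a g t - duhamel a g' t := by
  simp only [duhamel, mul_sub]
  rw [intervalIntegral.integral_sub, mul_sub] <;>
  exact Continuous.intervalIntegrable (by fun_prop) _ _

theorem duhamel_eq_zero {a t₀ : ℝ} {g : ℝ → ℝ} (h0 : 0 ≤ t₀) (hg : ∀ s ≤ t₀, g s = 0) {t : ℝ}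
    (ht : t ≤ t₀) : duhamel a g t = 0 := by
  rw [duhamel, intervalIntegral.integral_congr (g := fun _ => 0), intervalIntegral.integral_zero,
    mul_zero]
  intro s hs
  have : s ≤ t₀ := hs.2.trans (max_le h0 ht)
  simp [hg s this]

theorem abs_duhamel_le {a M t₀ : ℝ} {g : ℝ → ℝ} (hM : 0 ≤ M) (hg : Continuous g) (h0 : 0 ≤ t₀)
    (hg0 : ∀ s ≤ t₀, g s = 0) (hgM : ∀ s, |g s| ≤ a * M) (t : ℝ) : |duhamel a g t| ≤ M := by
  rcases le_total t 0 with ht | ht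
  · rw [duhamel_eq_zero h0 hg0 (ht.trans h0), abs_zero]
    exact hM
  · exact abs_le_of_relaxation hM
      (fun s _ => (hasDerivAt_duhamel a hg s).continuousAt.continuousWithinAt)
      (by simp [duhamel]) (fun s _ => hasDerivAt_duhamel a hg s) (fun s _ => hgM s) ht

theorem abs_exp_neg_mul_le {b C : ℝ} {k k' m : Fin d → ℤ} (hb : |b| ≤ C)
    (hk : absSum k ≤ absSum k' + absSum m) :
    |Real.exp (-absSum k') * b| ≤ Real.exp (absSum m) * Real.exp (-absSum k) * C := by
  rw [abs_mul, Real.abs_exp, ← Real.exp_add]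
  gcongr
  linarith

/-- Existence for the linear system with small coupling, as a perturbation of the heat flow: the
deviation `r` from the coefficients `e^{-λ_k t}` of the heat kernel is the fixed point of the
Duhamel map in the space of bounded functions with the weight `e^{|k|₁}`, where it is a
contraction. -/
theorem exists_coeffODE {ρ : ℝ → ℝ} {ε t₀ : ℝ} {w : Fin d → ℝ} {m : Fin d → ℤ}
    (hρc : Continuous ρ) (hρ : ∀ t, |ρ t| ≤ ε) (hρ0 : ∀ t ≤ t₀, ρ t = 0) (ht₀ : 1 ≤ t₀)
    (hε : ε * vecSum w * Real.exp (absSum m) ≤ 1) :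
    ∃ r : (Fin d → ℤ) → ℝ → ℝ, (∀ k, Continuous (r k)) ∧ (∀ k, ∀ t ≤ t₀, r k t = 0) ∧
      (∀ k t, |r k t| ≤ ε * vecSum w * Real.exp (absSum m) * Real.exp (-absSum k)) ∧
      CoeffODE ρ w m (fun k t => Real.exp (-eigenvalue k * t) + r k t) := by
  set κ : ℝ := ε * vecSum w * Real.exp (absSum m) / 2 with hκ
  have hε0 : 0 ≤ ε := (abs_nonneg _).trans (hρ 0)
  have hW := vecSum_nonneg w
  have hκ0 : 0 ≤ κ := by positivity
  -- removal of the weight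
  let U : BoundedContinuousFunction ((Fin d → ℤ) × ℝ) ℝ → (Fin d → ℤ) → ℝ → ℝ :=
    fun b k t => Real.exp (-absSum k) * b (k, t)
  have hUc : ∀ b k, Continuous (U b k) := fun b k =>
    continuous_const.mul (b.continuous.comp (by fun_prop))
  have hFc : ∀ b k, Continuous (coupling ρ w m (U b) k) := fun b k => by
    have h1 := hUc b (k + m)
    have h2 := hUc b (k - m)
    unfold coupling
    fun_prop
  have hF0 : ∀ b k, ∀ s ≤ t₀, coupling ρ w m (U b) k s = 0 := fun b k s hs => by
    simp [coupling, hρ0 s hs]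
  have hbound : ∀ b k t, |duhamel (eigenvalue k) (coupling ρ w m (U b) k) t|
      ≤ Real.exp (-absSum k) * (κ * ‖b‖) := by
    intro b k t
    refine abs_duhamel_le (by positivity) (hFc b k) (by linarith) (hF0 b k) (fun s => ?_) t
    have h1 := abs_coupling_le (w := w) (k := k) (m := m) (c := U b) (hρ s)
      (abs_exp_neg_mul_le (b.norm_coe_le_norm (k + m, s)) (absSum_le_add k m))
      (abs_exp_neg_mul_le (b.norm_coe_le_norm (k - m, s)) (absSum_le_sub k m))
    refine h1.trans (mul_le_mul_of_nonneg_left (le_of_eq ?_) (eigenvalue_nonneg k))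
    rw [hκ]
    ring
  have hbound' : ∀ b k t, |Real.exp (absSum k) * duhamel (eigenvalue k) (coupling ρ w m (U b) k) t|
      ≤ κ * ‖b‖ := by
    intro b k t
    rw [abs_mul, Real.abs_exp]
    refine (mul_le_mul_of_nonneg_left (hbound b k t) (Real.exp_pos _).le).trans (le_of_eq ?_)
    rw [← mul_assoc, ← Real.exp_add, add_neg_cancel, Real.exp_zero, one_mul]
  -- the linear part of the Duhamel map, with the weight restored
  let D : BoundedContinuousFunction ((Fin d → ℤ) × ℝ) ℝ →
      BoundedContinuousFunction ((Fin d → ℤ) × ℝ) ℝ :=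
    fun b => BoundedContinuousFunction.ofNormedAddCommGroup
    (fun p => Real.exp (absSum p.1) * duhamel (eigenvalue p.1) (coupling ρ w m (U b) p.1) p.2)
    (continuous_prod_of_discrete_left.2 fun k => (continuous_const (y := Real.exp (absSum k))).mul
      (continuous_iff_continuousAt.2 fun t =>
        (hasDerivAt_duhamel (eigenvalue k) (hFc b k) t).continuousAt))
    (κ * ‖b‖) (fun p => hbound' b p.1 p.2)
  have hD : ∀ b, ‖D b‖ ≤ κ * ‖b‖ := fun b =>
    BoundedContinuousFunction.norm_ofNormedAddCommGroup_le _ (by positivity) _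
  have hDsub : ∀ b b', D b - D b' = D (b - b') := by
    intro b b'
    ext p
    have h1 : coupling ρ w m (U (b - b')) p.1
        = fun s => coupling ρ w m (U b) p.1 s - coupling ρ w m (U b') p.1 s := by
      funext s
      simp only [coupling, U, BoundedContinuousFunction.sub_apply]
      ring
    simp only [D, BoundedContinuousFunction.sub_apply,
      BoundedContinuousFunction.coe_ofNormedAddCommGroup]
    rw [h1, duhamel_sub _ (hFc b p.1) (hFc b' p.1)]
    ring
  -- the heat kernel, frozen before time `t₀` so that its weighted coefficients are bounded
  let H : BoundedContinuousFunction ((Fin d → ℤ) × ℝ) ℝ :=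
    BoundedContinuousFunction.ofNormedAddCommGroup
    (fun p => Real.exp (absSum p.1) * Real.exp (-eigenvalue p.1 * max p.2 t₀))
    (continuous_prod_of_discrete_left.2 fun k => by fun_prop) 1 (fun p => by
      rw [← Real.exp_add, Real.norm_eq_abs, Real.abs_exp, Real.exp_le_one_iff]
      have h1 := mul_le_mul_of_nonneg_left (ht₀.trans (le_max_right p.2 t₀))
        (eigenvalue_nonneg p.1)
      linarith [absSum_le_eigenvalue p.1])
  have hH : ‖H‖ ≤ 1 := BoundedContinuousFunction.norm_ofNormedAddCommGroup_le _ zero_le_one _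
  have hcontr : ContractingWith (1 / 2 : ℝ≥0) fun b => D (b + H) := by
    refine ⟨by
      rw [← NNReal.coe_lt_coe]; norm_num, LipschitzWith.of_dist_le_mul fun b b' => ?_⟩
    rw [dist_eq_norm, dist_eq_norm, hDsub, add_sub_add_right_eq_sub]
    refine (hD _).trans ?_
    push_cast
    gcongr
    linarith
  obtain ⟨b, hb⟩ : ∃ b, b = D (b + H) :=
    ⟨_, (hcontr.fixedPoint_isFixedPt).symm⟩
  have hbnorm : ‖b‖ ≤ 2 * κ := by
    have h1 : ‖b‖ ≤ κ * (‖b‖ + ‖H‖) := by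
      calc ‖b‖ = ‖D (b + H)‖ := by rw [← hb]
        _ ≤ κ * ‖b + H‖ := hD _
        _ ≤ κ * (‖b‖ + ‖H‖) := by gcongr; exact norm_add_le _ _
    have h2 : κ * ‖H‖ ≤ κ * 1 := by gcongr
    have h3 : κ * ‖b‖ ≤ 1 / 2 * ‖b‖ := by gcongr; linarith
    linarith
  have hr : ∀ k t, U b k t = duhamel (eigenvalue k) (coupling ρ w m (U (b + H)) k) t := by
    intro k t
    have h1 : b (k, t) = D (b + H) (k, t) := by rw [← hb]
    simp only [U, h1, D, BoundedContinuousFunction.coe_ofNormedAddCommGroup]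
    rw [← mul_assoc, ← Real.exp_add, neg_add_cancel, Real.exp_zero, one_mul]
  have hforce : ∀ k, coupling ρ w m (U (b + H)) k
      = coupling ρ w m (fun k t => Real.exp (-eigenvalue k * t) + U b k t) k := by
    intro k
    funext s
    rcases le_total s t₀ with hs | hs
    · simp [coupling, hρ0 s hs]
    · have h1 : ∀ k, U (b + H) k s = Real.exp (-eigenvalue k * s) + U b k s := by
        intro k
        simp only [U, H, BoundedContinuousFunction.add_apply,
          BoundedContinuousFunction.coe_ofNormedAddCommGroup, max_eq_left hs, mul_add]
        rw [← mul_assoc, ← Real.exp_add, neg_add_cancel, Real.exp_zero, one_mul, add_comm]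
      simp only [coupling, h1]
  refine ⟨U b, hUc b, fun k t ht => ?_, fun k t => ?_, coeffODE_iff.2 fun k t ht => ?_⟩
  · rw [hr, duhamel_eq_zero (by linarith) (hF0 _ k) ht]
  · simp only [U, abs_mul, Real.abs_exp]
    rw [mul_comm]
    gcongr
    exact (b.norm_coe_le_norm _).trans (hbnorm.trans (by rw [hκ]; linarith))
  · have h1 : HasDerivAt (fun t => Real.exp (-eigenvalue k * t))
        (Real.exp (-eigenvalue k * t) * -eigenvalue k) t := by
      simpa using ((hasDerivAt_id t).const_mul (-eigenvalue k)).exp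
    have h2 := hasDerivAt_duhamel (eigenvalue k) (hFc (b + H) k) t
    rw [← hr, hforce] at h2
    have h3 : U b k = duhamel (eigenvalue k)
        (coupling ρ w m (fun k t => Real.exp (-eigenvalue k * t) + U b k t) k) := by
      funext t
      rw [hr, hforce]
    rw [← h3] at h2
    exact (h1.add h2).congr_deriv (by ring)

theorem CoeffODE.comp_neg {ρ : ℝ → ℝ} {w : Fin d → ℝ} {m : Fin d → ℤ}
    {c : (Fin d → ℤ) → ℝ → ℝ} (hc : CoeffODE ρ w m c) : CoeffODE ρ w m fun k => c (-k) := by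
  intro k t ht
  refine (hc (-k) t ht).congr_deriv ?_
  beta_reduce
  rw [pairing_neg, normSq_neg, show -(k + m) = -k - m by abel, show -(k - m) = -k + m by abel]
  ring

/-- Frequencies orthogonal to the direction of the shear evolve as under the heat flow. -/
theorem CoeffODE.eq_exp {ρ : ℝ → ℝ} {w : Fin d → ℝ} {m : Fin d → ℤ}
    {c : (Fin d → ℤ) → ℝ → ℝ} (hc : CoeffODE ρ w m c) {k : Fin d → ℤ}
    (hk : pairing k w = 0) (hcont : ContinuousOn (c k) (Ici 0)) (h0 : c k 0 = 1) {t : ℝ}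
    (ht : 0 ≤ t) : c k t = Real.exp (-eigenvalue k * t) := by
  have h := abs_le_of_relaxation (a := eigenvalue k) (M := 0) (g := fun _ => 0)
    (z := fun t => c k t - Real.exp (-eigenvalue k * t)) le_rfl
    (hcont.sub (by fun_prop)) (by simp [h0]) (fun s hs => ?_) (by simp) ht
  · exact sub_eq_zero.1 (abs_nonpos_iff.1 h)
  · have h1 : HasDerivAt (fun t => Real.exp (-eigenvalue k * t))
        (Real.exp (-eigenvalue k * s) * -eigenvalue k) s := by
      simpa using ((hasDerivAt_id s).const_mul (-eigenvalue k)).exp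
    refine ((coeffODE_iff.1 hc k s hs).sub h1).congr_deriv ?_
    simp only [coupling, hk]
    ring

/-! ### The heat kernel -/

/-- The heat kernel `e^{tΔ} δ_0`: the image on the torus of a Gaussian of variance `2t`. -/
noncomputable def heatMeasure (d : ℕ) (t : ℝ) : FiniteMeasure (FlatTorus d) :=
  ⟨(Measure.pi fun _ : Fin d => ProbabilityTheory.gaussianReal 0 (2 * t).toNNReal).map proj,
    inferInstance⟩

theorem integral_mFourier_heatMeasure {t : ℝ} (ht : 0 ≤ t) (k : Fin d → ℤ) :
    ∫ x, mFourier k x ∂(heatMeasure d t : Measure (FlatTorus d))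
      = (Real.exp (-eigenvalue k * t) : ℝ) := by
  have h1 : ∀ n : ℤ, ∫ y : ℝ, fourier n (y : UnitAddCircle)
      ∂(ProbabilityTheory.gaussianReal 0 (2 * t).toNNReal)
      = Complex.exp (-(4 * Real.pi ^ 2 * (n : ℝ) ^ 2 * t : ℝ)) := by
    intro n
    have h2 := ProbabilityTheory.charFun_gaussianReal (μ := 0) (v := (2 * t).toNNReal)
      (2 * Real.pi * n)
    rw [charFun_apply_real] at h2
    convert h2 using 1
    · refine integral_congr_ae (Eventually.of_forall fun y => ?_)
      simp only [fourier_coe_apply]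
      congr 1
      push_cast
      ring
    · congr 1
      rw [Real.coe_toNNReal _ (by linarith)]
      push_cast
      ring
  change ∫ x, mFourier k x ∂((Measure.pi fun _ : Fin d =>
    ProbabilityTheory.gaussianReal 0 (2 * t).toNNReal).map proj) = _
  rw [integral_map isOpenQuotientMap_proj.continuous.measurable.aemeasurable
    (mFourier k).continuous.aestronglyMeasurable]
  simp only [mFourier, ContinuousMap.coe_mk, proj]
  rw [integral_fintype_prod_eq_prod (f := fun i (y : ℝ) => fourier (k i) (y : UnitAddCircle))]
  simp only [h1, ← Complex.exp_sum]
  rw [Complex.ofReal_exp, eigenvalue, normSq]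
  congr 1
  push_cast
  rw [Finset.sum_neg_distrib, Finset.mul_sum, neg_mul, Finset.sum_mul]

theorem heatMeasure_zero : heatMeasure d 0 = diracZero d := by
  refine ext_of_integral_mFourier fun k => ?_
  rw [integral_mFourier_heatMeasure le_rfl]
  simp [diracZero, mFourier_apply_zero]

/-! ### Measures with prescribed, absolutely summable Fourier coefficients -/

/-- A symmetric real sequence `a` with `a 0 = 1` and `∑_{k ≠ 0} |a k| ≤ 1` is the sequence of
Fourier coefficients of a measure with continuous density `∑ a_k e_k ≥ 0`. -/
theorem exists_density_of_coeff {a : (Fin d → ℤ) → ℝ} (hs : Summable fun k => |a k|)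
    (hsym : ∀ k, a (-k) = a k) (h0 : a 0 = 1) (hsum : ∑' k, |a k| ≤ 2) :
    ∃ f : C(FlatTorus d, ℝ), (∀ x, 0 ≤ f x) ∧
      HasSum (fun k => a k ^ 2) (∫ x, f x ^ 2) ∧
      ∀ k, ∫ x, mFourier k x ∂(volume.withDensity fun x => ENNReal.ofReal (f x)) = a k := by
  have hs' : Summable fun k => ‖(a k : ℂ)‖ := by simpa using hs
  set F := series fun k => (a k : ℂ) with hF
  have hFsum : ∀ x, HasSum (fun k => (a k : ℂ) * mFourier k x) (F x) := hasSum_series_apply hs'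
  have hreal : ∀ x, ((F x).re : ℂ) = F x := by
    intro x
    refine Complex.conj_eq_iff_re.1 ?_
    have h1 := (Complex.hasSum_conj'.2 (hFsum x))
    have h2 := (Equiv.neg (Fin d → ℤ)).hasSum_iff.2 (hFsum x)
    refine h1.unique ?_
    convert h2 using 2 with k
    simp [hsym, mFourier_neg]
  have hpos : ∀ x, 0 ≤ (F x).re := by
    intro x
    have h1 := Complex.reCLM.hasSum (hFsum x)
    -- `Re (a_k e_k) ≥ -|a_k|` for `k ≠ 0`, while the term at `k = 0` equals `1 = 2 - |a_0|`
    have h2 : HasSum (fun k : Fin d → ℤ => (if k = 0 then (2 : ℝ) else 0) - |a k|)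
        (2 - ∑' k, |a k|) := (hasSum_ite_eq 0 2).sub hs.hasSum
    have h3 := hasSum_le (fun k => ?_) h2 h1
    · simp only [Complex.reCLM_apply] at h3
      linarith
    · simp only [Complex.reCLM_apply, Complex.re_ofReal_mul]
      split_ifs with hk
      · subst hk
        simp only [h0, mFourier_zero, ContinuousMap.one_apply, Complex.one_re, abs_one]
        norm_num
      · have h4 : |(mFourier k x).re| ≤ 1 :=
          (Complex.abs_re_le_norm _).trans (norm_mFourier_apply k x).le
        have h5 : |a k * (mFourier k x).re| ≤ |a k| := by
          rw [abs_mul]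
          exact mul_le_of_le_one_right (abs_nonneg _) h4
        linarith [(abs_le.1 h5).1]
  have hcoeff : ∀ k, ∫ x, mFourier k x * F x = (a k : ℂ) := by
    intro k
    have := coeff_series hs' (-k)
    rw [coeff, neg_neg, hsym] at this
    exact this
  refine ⟨⟨fun x => (F x).re, Complex.continuous_re.comp F.continuous⟩, hpos, ?_, fun k => ?_⟩
  · have h1 := hasSum_integral_series hs' F volume
    simp only [hcoeff, ← hF] at h1
    have h2 : ∫ x, F x * F x = ((∫ x, (F x).re ^ 2 : ℝ) : ℂ) := by
      have h3 : ∫ x, (((F x).re ^ 2 : ℝ) : ℂ) = ((∫ x, (F x).re ^ 2 : ℝ) : ℂ) := integral_ofReal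
      rw [← h3]
      refine integral_congr_ae (Eventually.of_forall fun x => ?_)
      beta_reduce
      rw [Complex.ofReal_pow, hreal, sq]
    rw [h2] at h1
    have h4 := Complex.reCLM.hasSum h1
    simp only [Complex.reCLM_apply, Complex.ofReal_re, ← Complex.ofReal_mul] at h4
    simpa only [ContinuousMap.coe_mk, sq] using h4
  · rw [integral_withDensity_eq_integral_toReal_smul (by fun_prop) (by simp), ← hcoeff k]
    refine integral_congr_ae (Eventually.of_forall fun x => ?_)
    simp only [ContinuousMap.coe_mk, ENNReal.toReal_ofReal (hpos x), Complex.real_smul, hreal]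
    ring

theorem isFiniteMeasure_withDensity_continuousMap (f : C(FlatTorus d, ℝ)) :
    IsFiniteMeasure (volume.withDensity fun x => ENNReal.ofReal (f x)) :=
  isFiniteMeasure_withDensity_ofReal
    (f.continuous.integrable_of_hasCompactSupport (HasCompactSupport.of_compactSpace _)).2

theorem l2Norm_of_density {μ : FiniteMeasure (FlatTorus d)} {f : C(FlatTorus d, ℝ)}
    (hμ : (μ : Measure (FlatTorus d)) = volume.withDensity fun x => ENNReal.ofReal (f x))
    (hf : ∀ x, 0 ≤ f x) :
    l2Norm μ = ENNReal.ofReal (∫ x, f x ^ 2) ^ (1 / 2 : ℝ) := by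
  have hac : (μ : Measure (FlatTorus d)) ≪ volume := hμ ▸ withDensity_absolutelyContinuous _ _
  have hrn : (μ : Measure (FlatTorus d)).rnDeriv volume
      =ᵐ[volume] fun x => ENNReal.ofReal (f x) := by
    rw [hμ]
    exact Measure.rnDeriv_withDensity _ (by fun_prop)
  have hint : Integrable (fun x : FlatTorus d => f x ^ 2) :=
    Continuous.integrable_of_hasCompactSupport (by fun_prop) (HasCompactSupport.of_compactSpace _)
  rw [l2Norm, if_pos hac, eLpNorm_congr_ae hrn,
    eLpNorm_eq_lintegral_rpow_enorm_toReal (by norm_num) (by norm_num),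
    ofReal_integral_eq_lintegral_ofReal hint (Eventually.of_forall fun x => sq_nonneg _)]
  simp only [enorm_eq_self, ENNReal.toReal_ofNat, ENNReal.rpow_ofNat]
  congr 2
  funext x
  rw [ENNReal.ofReal_pow (hf x)]

/-! ### Concentration controls the `L²` norm -/

theorem lintegral_Ioi_ofReal_sub {a : ℝ} (ha : 0 ≤ a) :
    ∫⁻ s in Ioi 0, ENNReal.ofReal (a - s) = ENNReal.ofReal (a ^ 2 / 2) := by
  have h1 : ∫⁻ s in Ioi 0, ENNReal.ofReal (a - s) = ∫⁻ s in Ioc 0 a, ENNReal.ofReal (a - s) := by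
    rw [← lintegral_indicator measurableSet_Ioi, ← lintegral_indicator measurableSet_Ioc]
    congr 1
    funext s
    simp only [indicator, mem_Ioi, mem_Ioc]
    by_cases h0 : 0 < s <;> by_cases h2 : s ≤ a <;> simp [h0, h2]
    exact (not_le.1 h2).le
  have h2 : ∫ s in (0 : ℝ)..a, (a - s) = a ^ 2 / 2 := by
    rw [intervalIntegral.integral_sub (by simp) (by simp)]
    simp
    ring
  rw [h1, ← ofReal_integral_eq_lintegral_ofReal, ← intervalIntegral.integral_of_le ha, h2]
  · exact (Continuous.integrableOn_Icc (by fun_prop)).mono_set Ioc_subset_Icc_self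
  · filter_upwards [ae_restrict_mem measurableSet_Ioc] with s hs
    simpa using hs.2

/-- For a density `f`, the superlevel set `{f > s}` maximizes `μ(E) - s |E|`, with value
`∫ (f - s)₊`. -/
theorem lintegral_sub_le_of_lessConcentrated {μ ν : FiniteMeasure (FlatTorus d)}
    {f g : C(FlatTorus d, ℝ)}
    (hμ : (μ : Measure (FlatTorus d)) = volume.withDensity fun x => ENNReal.ofReal (f x))
    (hν : (ν : Measure (FlatTorus d)) = volume.withDensity fun x => ENNReal.ofReal (g x))
    (h : LessConcentrated μ ν) {s : ℝ} (hs : 0 ≤ s) :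
    ∫⁻ x, ENNReal.ofReal (f x - s) ≤ ∫⁻ x, ENNReal.ofReal (g x - s) := by
  set E : Set (FlatTorus d) := {x | s < f x} with hE
  have hEm : MeasurableSet E := measurableSet_lt measurable_const f.continuous.measurable
  have hfin : volume E ≠ ⊤ := measure_ne_top _ _
  have h1 : (μ : Measure (FlatTorus d)) E
      = (∫⁻ x, ENNReal.ofReal (f x - s)) + ENNReal.ofReal s * volume E := by
    rw [hμ, withDensity_apply _ hEm]
    have e1 : ∫⁻ x in E, ENNReal.ofReal (f x)
        = ∫⁻ x in E, (ENNReal.ofReal (f x - s) + ENNReal.ofReal s) := by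
      refine setLIntegral_congr_fun hEm fun x hx => ?_
      rw [← ENNReal.ofReal_add (sub_nonneg.2 (le_of_lt hx)) hs, sub_add_cancel]
    rw [e1, lintegral_add_right _ measurable_const, setLIntegral_const]
    congr 1
    rw [← lintegral_indicator hEm]
    congr 1
    funext x
    by_cases hx : x ∈ E
    · simp [hx]
    · have : f x ≤ s := not_lt.1 hx
      simp [hx, this]
  have h2 : ∀ E' : Set (FlatTorus d), MeasurableSet E' → (ν : Measure (FlatTorus d)) E'
      ≤ (∫⁻ x, ENNReal.ofReal (g x - s)) + ENNReal.ofReal s * volume E' := by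
    intro E' hE'
    rw [hν, withDensity_apply _ hE']
    calc ∫⁻ x in E', ENNReal.ofReal (g x)
        ≤ ∫⁻ x in E', (ENNReal.ofReal (g x - s) + ENNReal.ofReal s) := by
          refine lintegral_mono fun x => ?_
          calc ENNReal.ofReal (g x) = ENNReal.ofReal ((g x - s) + s) := by rw [sub_add_cancel]
            _ ≤ _ := ENNReal.ofReal_add_le
      _ = (∫⁻ x in E', ENNReal.ofReal (g x - s)) + ENNReal.ofReal s * volume E' := by
          rw [lintegral_add_right _ measurable_const, setLIntegral_const]
      _ ≤ _ := by gcongr; exact Measure.restrict_le_self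
  have hα : volume E = ((volume E).toNNReal : ℝ≥0∞) := (ENNReal.coe_toNNReal hfin).symm
  have h3 : (μ : Measure (FlatTorus d)) E ≤ modulus μ (volume E).toNNReal :=
    le_iSup₂_of_le E hEm (le_iSup_of_le hα le_rfl)
  have h4 : modulus ν (volume E).toNNReal
      ≤ (∫⁻ x, ENNReal.ofReal (g x - s)) + ENNReal.ofReal s * volume E := by
    refine iSup₂_le fun E' hE' => iSup_le fun hvol => ?_
    rw [hα, ← hvol]
    exact h2 E' hE'
  have h5 := (h3.trans (h _)).trans h4
  rw [h1] at h5
  exact (ENNReal.add_le_add_iff_right (ENNReal.mul_ne_top ENNReal.ofReal_ne_top hfin)).1 h5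

/-- A less concentrated density has a smaller `L²` norm, by the layer-cake formula
`f² = 2 ∫_0^∞ (f - s)₊ ds`. -/
theorem integral_sq_le_of_lessConcentrated {μ ν : FiniteMeasure (FlatTorus d)}
    {f g : C(FlatTorus d, ℝ)}
    (hμ : (μ : Measure (FlatTorus d)) = volume.withDensity fun x => ENNReal.ofReal (f x))
    (hν : (ν : Measure (FlatTorus d)) = volume.withDensity fun x => ENNReal.ofReal (g x))
    (hf : ∀ x, 0 ≤ f x) (hg : ∀ x, 0 ≤ g x) (h : LessConcentrated μ ν) :
    ∫ x, f x ^ 2 ≤ ∫ x, g x ^ 2 := by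
  have hlayer : ∀ f : C(FlatTorus d, ℝ), (∀ x, 0 ≤ f x) →
      ENNReal.ofReal (∫ x, f x ^ 2 / 2)
        = ∫⁻ s in Ioi (0 : ℝ), ∫⁻ x, ENNReal.ofReal (f x - s) := by
    intro f hf
    rw [ofReal_integral_eq_lintegral_ofReal
      (Continuous.integrable_of_hasCompactSupport (by fun_prop)
        (HasCompactSupport.of_compactSpace _))
      (Eventually.of_forall fun x => by positivity), lintegral_lintegral_swap]
    · simp only [lintegral_Ioi_ofReal_sub (hf _)]
    · exact (ENNReal.continuous_ofReal.comp
        ((f.continuous.comp continuous_snd).sub continuous_fst)).aemeasurable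
  have h1 : ENNReal.ofReal (∫ x, f x ^ 2 / 2) ≤ ENNReal.ofReal (∫ x, g x ^ 2 / 2) := by
    rw [hlayer f hf, hlayer g hg]
    refine setLIntegral_mono' measurableSet_Ioi fun s hs => ?_
    exact lintegral_sub_le_of_lessConcentrated hμ hν h (le_of_lt hs)
  rw [ENNReal.ofReal_le_ofReal_iff (integral_nonneg fun x => by positivity),
    integral_div, integral_div] at h1
  linarith

/-! ### Well-posedness for weak shear flows starting from the Dirac mass -/

theorem normSq_zero : normSq (0 : Fin d → ℤ) = 0 := by simp [normSq]

theorem absSum_zero : absSum (0 : Fin d → ℤ) = 0 := by simp [absSum]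

theorem eigenvalue_zero : eigenvalue (0 : Fin d → ℤ) = 0 := by simp [eigenvalue, normSq_zero]

theorem pairing_zero (w : Fin d → ℝ) : pairing 0 w = 0 := by simp [pairing]

theorem integral_mFourier_diracZero (k : Fin d → ℤ) :
    ∫ x, mFourier k x ∂(diracZero d : Measure (FlatTorus d)) = 1 := by
  simp [diracZero, mFourier_apply_zero]

theorem IsSolution.mass_eq_one {ρ : ℝ → ℝ} {w : Fin d → ℝ} {m : Fin d → ℤ}
    {θ : ℝ → FiniteMeasure (FlatTorus d)} (h : IsSolution (shear ρ w m) (diracZero d) θ)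
    {t : ℝ} (ht : 0 ≤ t) : ((θ t).mass : ℝ) = 1 := by
  have h1 := (h.coeffODE Complex.reCLM).eq_exp (pairing_zero w)
    (h.continuousOn_coeff Complex.reCLM 0) (by
      rw [h.initial, integral_mFourier_diracZero]; simp) ht
  simpa [integral_mFourier_zero, eigenvalue_zero] using h1

/-- Uniqueness for weak shears: the real and imaginary parts of the Fourier coefficients are
bounded solutions of the linear system, hence determined by their initial values. -/
theorem IsSolution.eqOn {ρ : ℝ → ℝ} {ε : ℝ} {w : Fin d → ℝ} {m : Fin d → ℤ}
    (hρ : ∀ t, |ρ t| ≤ ε) (hε : ε * vecSum w ≤ 1) {θ θ' : ℝ → FiniteMeasure (FlatTorus d)}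
    (h : IsSolution (shear ρ w m) (diracZero d) θ)
    (h' : IsSolution (shear ρ w m) (diracZero d) θ') : EqOn θ' θ (Ici 0) := by
  have key : ∀ L : ℂ →L[ℝ] ℝ, (∀ z, |L z| ≤ ‖z‖) → ∀ k, ∀ t, 0 ≤ t →
      L (∫ x, mFourier k x ∂(θ' t : Measure (FlatTorus d)))
        = L (∫ x, mFourier k x ∂(θ t : Measure (FlatTorus d))) := by
    intro L hL k t ht
    have hbd : ∀ {η : ℝ → FiniteMeasure (FlatTorus d)},
        IsSolution (shear ρ w m) (diracZero d) η → ∀ (k : Fin d → ℤ) (t : ℝ), 0 ≤ t →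
        |L (∫ x, mFourier k x ∂(η t : Measure (FlatTorus d)))| ≤ 1 := by
      intro η hη k t ht
      refine (hL _).trans ((norm_integral_le_mass (η t) (mFourier k)).trans ?_)
      rw [mFourier_norm, hη.mass_eq_one ht, one_mul]
    exact CoeffODE.unique hρ hε (h'.coeffODE L) (h.coeffODE L) (h'.continuousOn_coeff L)
      (h.continuousOn_coeff L) (hbd h') (hbd h) (fun k => by rw [h.initial, h'.initial]) k ht
  intro t ht
  refine ext_of_integral_mFourier fun k => Complex.ext ?_ ?_
  · exact key Complex.reCLM Complex.abs_re_le_norm k t ht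
  · exact key Complex.imCLM Complex.abs_im_le_norm k t ht

theorem one_le_absSum {k : Fin d → ℤ} (hk : k ≠ 0) : 1 ≤ absSum k := by
  obtain ⟨i, hi⟩ := Function.ne_iff.mp hk
  have h1 : (1 : ℝ) ≤ |(k i : ℝ)| := by
    rw [← Int.cast_abs]
    exact_mod_cast Int.one_le_abs hi
  exact h1.trans (Finset.single_le_sum (f := fun i => |(k i : ℝ)|) (fun _ _ => abs_nonneg _)
    (Finset.mem_univ i))

theorem summable_exp_neg_absSum : Summable fun k : Fin d → ℤ => Real.exp (-absSum k) := by
  have h1 : Summable fun n : ℤ => Real.exp (-|(n : ℝ)|) := by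
    refine Summable.of_nonneg_of_le (fun n => (Real.exp_pos _).le) (fun n => ?_)
      (summable_inv_one_add_sq_int.mul_left 2)
    have h2 := Real.quadratic_le_exp_of_nonneg (abs_nonneg (n : ℝ))
    rw [sq_abs] at h2
    rw [Real.exp_neg, ← div_eq_mul_inv, inv_le_comm₀ (Real.exp_pos _) (by positivity), inv_div]
    linarith [abs_nonneg (n : ℝ)]
  refine (summable_prod_apply (d := d) (fun n => (Real.exp_pos _).le) h1).congr fun k => ?_
  rw [← Real.exp_sum, absSum, Finset.sum_neg_distrib]

theorem exp_neg_eigenvalue_mul_le {k : Fin d → ℤ} {a t : ℝ} (ha : a ≤ eigenvalue k) (ht : 1 ≤ t) :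
    Real.exp (-eigenvalue k * t) ≤ Real.exp (-(a * (t - 1))) * Real.exp (-absSum k) := by
  rw [← Real.exp_add, Real.exp_le_exp]
  have h1 := absSum_le_eigenvalue k
  nlinarith [mul_le_mul_of_nonneg_right ha (sub_nonneg.2 ht)]

/-- The finite measure with density the positive part of `f`. -/
noncomputable def densityMeasure (f : C(FlatTorus d, ℝ)) : FiniteMeasure (FlatTorus d) :=
  ⟨volume.withDensity fun x => ENNReal.ofReal (f x), isFiniteMeasure_withDensity_continuousMap f⟩

/-- For a weak shear acting only after a large time `t₀`, the advection-diffusion equation is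
well-posed from the Dirac mass. The solution is a small perturbation of the heat kernel, which is
bounded below after time `t₀`; this makes it positive, and it has a continuous density. -/
theorem exists_isTheSolution_shear {ρ : ℝ → ℝ} {ε t₀ : ℝ} {w : Fin d → ℝ} {m : Fin d → ℤ}
    (hρc : Continuous ρ) (hρ : ∀ t, |ρ t| ≤ ε) (hρ0 : ∀ t ≤ t₀, ρ t = 0) (ht₀ : 1 ≤ t₀)
    (hε : ε * vecSum w * Real.exp (absSum m) ≤ 1)
    (hheat : Real.exp (-(t₀ - 1)) * ∑' k : Fin d → ℤ, Real.exp (-absSum k) ≤ 1 / 2)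
    (hpert : ε * vecSum w * Real.exp (absSum m) * ∑' k : Fin d → ℤ, Real.exp (-absSum k)
      ≤ 1 / 2) :
    ∃ (c : (Fin d → ℤ) → ℝ → ℝ) (θ : ℝ → FiniteMeasure (FlatTorus d)),
      CoeffODE ρ w m c ∧ (∀ k, Continuous (c k)) ∧ (∀ k, ∀ t, 0 ≤ t → c (-k) t = c k t) ∧
      (∀ k, ∀ t ≤ t₀, c k t = Real.exp (-eigenvalue k * t)) ∧
      (∀ k t, |c k t - Real.exp (-eigenvalue k * t)|
        ≤ ε * vecSum w * Real.exp (absSum m) * Real.exp (-absSum k)) ∧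
      IsTheSolution (shear ρ w m) (diracZero d) θ ∧
      ∀ t, t₀ ≤ t → ∃ f : C(FlatTorus d, ℝ), (∀ x, 0 ≤ f x) ∧
        (θ t : Measure (FlatTorus d)) = volume.withDensity (fun x => ENNReal.ofReal (f x)) ∧
        HasSum (fun k => c k t ^ 2) (∫ x, f x ^ 2) := by
  obtain ⟨r, hrc, hr0, hr, hode⟩ := exists_coeffODE hρc hρ hρ0 ht₀ hε
  set δ := ε * vecSum w * Real.exp (absSum m) with hδ
  have hε0 : 0 ≤ ε := (abs_nonneg _).trans (hρ 0)
  have hεw : 0 ≤ ε * vecSum w := mul_nonneg hε0 (vecSum_nonneg w)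
  have hδ0 : 0 ≤ δ := by positivity
  have hε1 : ε * vecSum w ≤ 1 :=
    (le_mul_of_one_le_right hεw (Real.one_le_exp (absSum_nonneg m))).trans hε
  set c : (Fin d → ℤ) → ℝ → ℝ := fun k t => Real.exp (-eigenvalue k * t) + r k t with hc
  have hcc : ∀ k, Continuous (c k) := fun k => by
    have := hrc k
    simp only [hc]
    fun_prop
  have hcheat : ∀ k, ∀ t ≤ t₀, c k t = Real.exp (-eigenvalue k * t) := fun k t ht => by
    simp [hc, hr0 k t ht]
  have hcinit : ∀ k, c k 0 = 1 := fun k => by rw [hcheat k 0 (by linarith)]; simp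
  have hc0 : ∀ t, 0 ≤ t → c 0 t = 1 := fun t ht => by
    rw [hode.eq_exp (pairing_zero w) (hcc 0).continuousOn (hcinit 0) ht, eigenvalue_zero]
    simp
  have hcb : ∀ k t, 0 ≤ t → |c k t| ≤ 2 := by
    intro k t ht
    have h1 : Real.exp (-eigenvalue k * t) ≤ 1 := Real.exp_le_one_iff.2 (by
      have := mul_nonneg (eigenvalue_nonneg k) ht
      linarith)
    have h2 : δ * Real.exp (-absSum k) ≤ 1 * 1 := by
      gcongr
      exact Real.exp_le_one_iff.2 (by linarith [absSum_nonneg k])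
    refine (abs_add_le _ _).trans ?_
    rw [Real.abs_exp]
    linarith [hr k t]
  have hsym : ∀ k, ∀ t, 0 ≤ t → c (-k) t = c k t := fun k t ht =>
    CoeffODE.unique (c := fun k => c (-k)) hρ hε1 hode.comp_neg hode
      (fun k => (hcc (-k)).continuousOn) (fun k => (hcc k).continuousOn) (fun k => hcb (-k)) hcb
      (fun k => by rw [hcinit, hcinit]) k ht
  have hdens : ∀ t, t₀ ≤ t → ∃ f : C(FlatTorus d, ℝ), (∀ x, 0 ≤ f x) ∧
      HasSum (fun k => c k t ^ 2) (∫ x, f x ^ 2) ∧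
      ∀ k, ∫ x, mFourier k x ∂(volume.withDensity fun x => ENNReal.ofReal (f x)) = c k t := by
    intro t ht
    have hb : ∀ k : Fin d → ℤ, |c k t| ≤ (if k = 0 then 1 else 0)
        + (Real.exp (-(t₀ - 1)) + δ) * Real.exp (-absSum k) := by
      intro k
      split_ifs with hk
      · subst hk
        rw [hc0 t (by linarith), abs_one, absSum_zero]
        have := Real.exp_pos (-(t₀ - 1))
        simp only [neg_zero, Real.exp_zero, mul_one]
        linarith
      · have h1 := exp_neg_eigenvalue_mul_le
          ((one_le_absSum hk).trans (absSum_le_eigenvalue k)) (ht₀.trans ht)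
        have h2 : Real.exp (-(1 * (t - 1))) * Real.exp (-absSum k)
            ≤ Real.exp (-(t₀ - 1)) * Real.exp (-absSum k) := by
          gcongr
          linarith
        refine (abs_add_le _ _).trans ?_
        rw [Real.abs_exp]
        linarith [hr k t]
    -- the right-hand sides sum to at most `1 + 1/2 + 1/2`
    have hs : HasSum (fun k : Fin d → ℤ => (if k = 0 then (1 : ℝ) else 0)
        + (Real.exp (-(t₀ - 1)) + δ) * Real.exp (-absSum k))
        (1 + (Real.exp (-(t₀ - 1)) + δ) * ∑' k : Fin d → ℤ, Real.exp (-absSum k)) :=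
      (hasSum_ite_eq 0 1).add (summable_exp_neg_absSum.hasSum.mul_left _)
    have hsum : Summable fun k => |c k t| :=
      Summable.of_nonneg_of_le (fun k => abs_nonneg _) hb hs.summable
    refine exists_density_of_coeff hsum (fun k => hsym k t (by linarith)) (hc0 t (by linarith)) ?_
    have := hasSum_le hb hsum.hasSum hs
    linarith
  choose! f hf0 hfsum hfcoeff using hdens
  let θ : ℝ → FiniteMeasure (FlatTorus d) := fun t => 
    if t₀ ≤ t then densityMeasure (f t) else heatMeasure d t
  have hθcoeff : ∀ t, 0 ≤ t → ∀ k, ∫ x, mFourier k x ∂(θ t : Measure (FlatTorus d)) = c k t := by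
    intro t ht k
    by_cases h : t₀ ≤ t
    · simp only [θ, if_pos h]
      exact hfcoeff t h k
    · simp only [θ, if_neg h]
      rw [integral_mFourier_heatMeasure ht, hcheat k t (not_le.1 h).le]
  have hθ0 : θ 0 = diracZero d := by
    simp only [θ, if_neg (show ¬ t₀ ≤ 0 by linarith), heatMeasure_zero]
  have hsol : IsSolution (shear ρ w m) (diracZero d) θ := hθ0 ▸
    isSolution_shear_of_coeffODE hρ hode (fun k => (hcc k).continuousOn) hc0 hθcoeff
  refine ⟨c, θ, hode, hcc, hsym, hcheat, fun k t => ?_,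
    ⟨hsol, fun θ' h' => hsol.eqOn hρ hε1 h'⟩, fun t ht => ⟨f t, hf0 t ht, ?_, hfsum t ht⟩⟩
  · simpa [hc] using hr k t
  · simp only [θ, if_pos ht]
    rfl

/-! ### Growth of the first modes -/

/-- The frequency with entries `a`, `b` at positions `i`, `j`, and zero elsewhere. -/
def planeFreq (i j : Fin d) (a b : ℤ) : Fin d → ℤ := Pi.single i a + Pi.single j b

/-- The direction `2 e_i - e_j` of the shear, orthogonal to the frequency `e_i + 2 e_j`. -/
def shearDir (i j : Fin d) : Fin d → ℝ := Pi.single i 2 + Pi.single j (-1)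

theorem planeFreq_add (i j : Fin d) (a b a' b' : ℤ) :
    planeFreq i j a b + planeFreq i j a' b' = planeFreq i j (a + a') (b + b') := by
  simp only [planeFreq, Pi.single_add]
  abel

theorem planeFreq_neg (i j : Fin d) (a b : ℤ) :
    -planeFreq i j a b = planeFreq i j (-a) (-b) := by
  simp only [planeFreq, Pi.single_neg]
  abel

theorem planeFreq_sub (i j : Fin d) (a b a' b' : ℤ) :
    planeFreq i j a b - planeFreq i j a' b' = planeFreq i j (a - a') (b - b') := by
  rw [sub_eq_add_neg, planeFreq_neg, planeFreq_add, sub_eq_add_neg, sub_eq_add_neg]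

theorem planeFreq_apply_left {i j : Fin d} (hij : i ≠ j) (a b : ℤ) : planeFreq i j a b i = a := by
  simp [planeFreq, hij]

theorem planeFreq_apply_right {i j : Fin d} (hij : i ≠ j) (a b : ℤ) : planeFreq i j a b j = b := by
  simp [planeFreq, hij.symm]

theorem planeFreq_inj {i j : Fin d} (hij : i ≠ j) {a b a' b' : ℤ} :
    planeFreq i j a b = planeFreq i j a' b' ↔ a = a' ∧ b = b' := by
  refine ⟨fun h => ⟨?_, ?_⟩, by rintro ⟨rfl, rfl⟩; rfl⟩
  · simpa only [planeFreq_apply_left hij] using congrFun h i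
  · simpa only [planeFreq_apply_right hij] using congrFun h j

theorem normSq_planeFreq {i j : Fin d} (hij : i ≠ j) (a b : ℤ) :
    normSq (planeFreq i j a b) = (a : ℝ) ^ 2 + (b : ℝ) ^ 2 := by
  have h : ∀ l, ((planeFreq i j a b l : ℤ) : ℝ) ^ 2
      = (if l = i then (a : ℝ) ^ 2 else 0) + (if l = j then (b : ℝ) ^ 2 else 0) := by
    intro l
    by_cases h1 : l = i
    · subst h1
      simp [planeFreq_apply_left hij, hij]
    · by_cases h2 : l = j
      · subst h2
        simp [planeFreq_apply_right hij, h1]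
      · simp [planeFreq, h1, h2]
  simp [normSq, h, Finset.sum_add_distrib]

theorem pairing_shearDir (i j : Fin d) (k : Fin d → ℤ) :
    pairing k (shearDir i j) = 2 * k i - k j := by
  simp only [pairing, shearDir, Pi.add_apply, mul_add, Finset.sum_add_distrib, Pi.single_apply,
    mul_ite, mul_zero, Finset.sum_ite_eq', Finset.mem_univ, if_true]
  ring

theorem pairing_planeFreq {i j : Fin d} (hij : i ≠ j) (a b : ℤ) :
    pairing (planeFreq i j a b) (shearDir i j) = 2 * a - b := by
  rw [pairing_shearDir, planeFreq_apply_left hij, planeFreq_apply_right hij]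

/-- A lattice vector with `|k|² < 2` and a nonzero entry is a signed unit vector. -/
theorem eq_single_of_normSq_lt_two {k : Fin d → ℤ} (h : normSq k < 2) {i : Fin d} (hi : k i ≠ 0) :
    k = Pi.single i 1 ∨ k = Pi.single i (-1) := by
  have h1 : normSq k = ((∑ l, k l ^ 2 : ℤ) : ℝ) := by simp [normSq]
  have h2 : ∑ l, k l ^ 2 < 2 := by
    rw [h1] at h
    exact_mod_cast h
  rw [← Finset.add_sum_erase _ _ (Finset.mem_univ i)] at h2
  have h3 : 0 ≤ ∑ l ∈ Finset.univ.erase i, k l ^ 2 := Finset.sum_nonneg fun _ _ => sq_nonneg _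
  have h4 : 0 < k i ^ 2 := by positivity
  have h5 : ∑ l ∈ Finset.univ.erase i, k l ^ 2 = 0 := by omega
  have h6 : ∀ l, l ≠ i → k l = 0 := fun l hl => by
    have := (Finset.sum_eq_zero_iff_of_nonneg fun _ _ => sq_nonneg _).1 h5 l (by simp [hl])
    exact pow_eq_zero_iff two_ne_zero |>.1 this
  have h7 : k i ^ 2 = 1 := by omega
  have hk : k = Pi.single i (k i) := funext fun l => by
    by_cases hl : l = i
    · subst hl
      simp
    · simp [hl, h6 l hl]
  have h8 : (k i - 1) * (k i + 1) = 0 := by linear_combination h7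
  rcases mul_eq_zero.1 h8 with h9 | h9
  · left
    rwa [sub_eq_zero.1 h9] at hk
  · right
    rwa [eq_neg_of_add_eq_zero_left h9] at hk

theorem exp_neg_eigenvalue {k : Fin d → ℤ} {n : ℕ} (hn : normSq k = n) (t : ℝ) :
    Real.exp (-eigenvalue k * t) = Real.exp (-(4 * Real.pi ^ 2 * t)) ^ n := by
  rw [eigenvalue, hn, ← Real.exp_nat_mul]
  congr 1
  ring

theorem CoeffODE.hasDerivAt_exp_mul {ρ : ℝ → ℝ} {w : Fin d → ℝ} {m : Fin d → ℤ}
    {c : (Fin d → ℤ) → ℝ → ℝ} (hc : CoeffODE ρ w m c) {k : Fin d → ℤ} (hk : normSq k = 1)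
    {t : ℝ} (ht : 0 < t) :
    HasDerivAt (fun t => Real.exp (4 * Real.pi ^ 2 * t) * c k t)
      (Real.exp (4 * Real.pi ^ 2 * t) * coupling ρ w m c k t) t := by
  have h1 : HasDerivAt (fun t => Real.exp (4 * Real.pi ^ 2 * t))
      (Real.exp (4 * Real.pi ^ 2 * t) * (4 * Real.pi ^ 2)) t := by
    simpa using ((hasDerivAt_id t).const_mul (4 * Real.pi ^ 2)).exp
  refine (h1.mul (coeffODE_iff.1 hc k t ht)).congr_deriv ?_
  rw [eigenvalue, hk]
  ring

theorem exp_neg_four_pi_sq_mul_lt {t : ℝ} (ht : 1 ≤ t) :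
    Real.exp (-(4 * Real.pi ^ 2 * t)) < 1 / 4 := by
  have hpi := Real.pi_gt_three
  have h1 : 4 < 4 * Real.pi ^ 2 * t := by nlinarith
  rw [Real.exp_neg, one_div]
  refine inv_strictAnti₀ (by norm_num) (h1.trans ?_)
  linarith [Real.add_one_le_exp (4 * Real.pi ^ 2 * t)]

/-- The shear feeds the two first modes: up to the deviation `δ` from the heat kernel, the sum of
their couplings is `πρ(t)` times `q² - 2q⁴ + 2q⁸ - q¹⁰ ≥ q²/2`, with `q = e^{-4π²t}`. -/
theorem coupling_add_coupling_ge {ρ : ℝ → ℝ} {i j : Fin d} (hij : i ≠ j)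
    {c : (Fin d → ℤ) → ℝ → ℝ} {t δ : ℝ} (ht : 1 ≤ t) (hρ : 0 ≤ ρ t)
    (hc : ∀ k, |c k t - Real.exp (-eigenvalue k * t)| ≤ δ) :
    Real.pi * ρ t * (Real.exp (-(4 * Real.pi ^ 2 * t)) ^ 2 / 2 - 6 * δ)
      ≤ coupling ρ (shearDir i j) (planeFreq i j 1 2) c (planeFreq i j 1 0) t
        + coupling ρ (shearDir i j) (planeFreq i j 1 2) c (planeFreq i j 0 1) t := by
  have hq0 := Real.exp_pos (-(4 * Real.pi ^ 2 * t))
  have hq1 := exp_neg_four_pi_sq_mul_lt ht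
  have hval : ∀ (a b : ℤ) (n : ℕ), a ^ 2 + b ^ 2 = n →
      |c (planeFreq i j a b) t - Real.exp (-(4 * Real.pi ^ 2 * t)) ^ n| ≤ δ := by
    intro a b n h
    rw [← exp_neg_eigenvalue (k := planeFreq i j a b)]
    · exact hc _
    · rw [normSq_planeFreq hij]
      exact_mod_cast h
  set q := Real.exp (-(4 * Real.pi ^ 2 * t)) with hq
  have h1 := abs_le.1 (hval 2 2 8 (by norm_num))
  have h2 := abs_le.1 (hval 0 (-2) 4 (by norm_num))
  have h3 := abs_le.1 (hval 1 3 10 (by norm_num))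
  have h4 := abs_le.1 (hval (-1) (-1) 2 (by norm_num))
  have h5 : q ^ 2 ≤ 1 / 16 := by nlinarith
  have h6 : q ^ 4 ≤ q ^ 2 / 16 := by nlinarith [sq_nonneg q]
  have h7 : 0 ≤ q ^ 8 := by positivity
  have h8 : q ^ 10 ≤ q ^ 2 / 16 := by
    have : q ^ 8 ≤ 1 / 16 := by
      calc q ^ 8 ≤ q ^ 2 := pow_le_pow_of_le_one hq0.le (by linarith) (by norm_num)
        _ ≤ _ := h5
    nlinarith [sq_nonneg q]
  have key : q ^ 2 / 2 - 6 * δ ≤ 2 * (c (planeFreq i j 2 2) t - c (planeFreq i j 0 (-2)) t)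
      - (c (planeFreq i j 1 3) t - c (planeFreq i j (-1) (-1)) t) := by
    linarith [h1.1, h2.2, h3.2, h4.1, h7, sq_nonneg q]
  have := mul_le_mul_of_nonneg_left key (mul_nonneg Real.pi_pos.le hρ)
  simp only [coupling, planeFreq_add, planeFreq_sub, pairing_planeFreq hij]
  norm_num
  linarith

/-- Comparison of the sums of squares: all modes other than the four first modes `±e_i, ±e_j`
are either unaffected by the shear, or have a heat coefficient of size at most `e^{-8π²t}`. -/
theorem sum_sq_gt {i j : Fin d} (hij : i ≠ j) {ρ : ℝ → ℝ} {m : Fin d → ℤ}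
    {c : (Fin d → ℤ) → ℝ → ℝ} (hode : CoeffODE ρ (shearDir i j) m c)
    (hcc : ∀ k, Continuous (c k)) (hsym : ∀ k, ∀ t, 0 ≤ t → c (-k) t = c k t)
    (hc0 : ∀ k, c k 0 = 1) {t Y A B : ℝ} (ht : 1 ≤ t) (hY : 2 < Y)
    (hY' : Y ≤ Real.exp (4 * Real.pi ^ 2 * t) * c (planeFreq i j 1 0) t
      + Real.exp (4 * Real.pi ^ 2 * t) * c (planeFreq i j 0 1) t)
    (hsmall : Real.exp (-(4 * Real.pi ^ 2 * t)) ^ 2 * (Real.exp (16 * Real.pi ^ 2)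
      * ∑' k : Fin d → ℤ, Real.exp (-absSum k)) < Y ^ 2 - 4)
    (hA : HasSum (fun k => c k t ^ 2) A)
    (hB : HasSum (fun k : Fin d → ℤ => Real.exp (-eigenvalue k * t) ^ 2) B) : B < A := by
  classical
  set q := Real.exp (-(4 * Real.pi ^ 2 * t)) with hq
  set Z := ∑' k : Fin d → ℤ, Real.exp (-absSum k) with hZ
  have hq0 : 0 < q := Real.exp_pos _
  have hqq : Real.exp (4 * Real.pi ^ 2 * t) * q = 1 := by rw [hq, ← Real.exp_add]; simp
  set y₁ := Real.exp (4 * Real.pi ^ 2 * t) * c (planeFreq i j 1 0) t with hy₁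
  set y₂ := Real.exp (4 * Real.pi ^ 2 * t) * c (planeFreq i j 0 1) t with hy₂
  have e₁ : c (planeFreq i j 1 0) t = q * y₁ := by
    rw [hy₁]; linear_combination (-c (planeFreq i j 1 0) t) * hqq
  have e₂ : c (planeFreq i j 0 1) t = q * y₂ := by
    rw [hy₂]; linear_combination (-c (planeFreq i j 0 1) t) * hqq
  let S : Finset (Fin d → ℤ) :=
    {planeFreq i j 1 0, planeFreq i j (-1) 0, planeFreq i j 0 1, planeFreq i j 0 (-1)}
  let F : (Fin d → ℤ) → ℝ := fun k =>
    if k ∈ S then c k t ^ 2 - Real.exp (-eigenvalue k * t) ^ 2 else 0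
  have hF : HasSum F (∑ k ∈ S, F k) := hasSum_sum_of_ne_finset_zero fun k hk => if_neg hk
  have hunit : ∀ a b : ℤ, a ^ 2 + b ^ 2 = 1 →
      Real.exp (-eigenvalue (planeFreq i j a b) * t) = q := by
    intro a b hab
    rw [exp_neg_eigenvalue (n := 1), pow_one]
    rw [normSq_planeFreq hij]
    exact_mod_cast hab
  have hFS : ∑ k ∈ S, F k = 2 * (q ^ 2 * y₁ ^ 2 - q ^ 2) + 2 * (q ^ 2 * y₂ ^ 2 - q ^ 2) := by
    have h1 : ∑ k ∈ S, F k = ∑ k ∈ S, (c k t ^ 2 - Real.exp (-eigenvalue k * t) ^ 2) :=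
      Finset.sum_congr rfl fun k hk => if_pos hk
    have s₁ : c (planeFreq i j (-1) 0) t = q * y₁ := by
      rw [← e₁, ← hsym _ t (by linarith), planeFreq_neg]; norm_num
    have s₂ : c (planeFreq i j 0 (-1)) t = q * y₂ := by
      rw [← e₂, ← hsym _ t (by linarith), planeFreq_neg]; norm_num
    rw [h1, Finset.sum_insert, Finset.sum_insert, Finset.sum_insert, Finset.sum_singleton,
      hunit 1 0 (by norm_num), hunit (-1) 0 (by norm_num), hunit 0 1 (by norm_num),
      hunit 0 (-1) (by norm_num), e₁, e₂, s₁, s₂]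
    · ring
    all_goals simp [planeFreq_inj hij]
  have hrest : HasSum (fun k : Fin d → ℤ => q ^ 4 * Real.exp (16 * Real.pi ^ 2) *
      Real.exp (-absSum k)) (q ^ 4 * Real.exp (16 * Real.pi ^ 2) * Z) :=
    summable_exp_neg_absSum.hasSum.mul_left _
  have hle : ∀ k, F k - q ^ 4 * Real.exp (16 * Real.pi ^ 2) * Real.exp (-absSum k)
      ≤ c k t ^ 2 - Real.exp (-eigenvalue k * t) ^ 2 := by
    intro k
    have hpos : 0 ≤ q ^ 4 * Real.exp (16 * Real.pi ^ 2) * Real.exp (-absSum k) := by positivity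
    by_cases hk : k ∈ S
    · simp only [F, if_pos hk]
      linarith
    simp only [F, if_neg hk]
    by_cases hp : pairing k (shearDir i j) = 0
    · rw [hode.eq_exp hp (hcc k).continuousOn (hc0 k) (by linarith)]
      linarith
    have hn : 2 ≤ normSq k := by
      by_contra! hlt
      rw [pairing_shearDir] at hp
      have hor : k i ≠ 0 ∨ k j ≠ 0 := by
        by_contra! h0
        rw [h0.1, h0.2] at hp
        simp at hp
      refine hk ?_
      rcases hor with h0 | h0 <;> rcases eq_single_of_normSq_lt_two hlt h0 with h1 | h1 <;>
        simp [S, planeFreq, h1]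
    have h1 := exp_neg_eigenvalue_mul_le (a := 8 * Real.pi ^ 2) (k := k) (by
      rw [eigenvalue]; nlinarith [sq_nonneg Real.pi]) ht
    have h2 : Real.exp (-(8 * Real.pi ^ 2 * (t - 1))) = q ^ 2 * Real.exp (8 * Real.pi ^ 2) := by
      rw [hq, ← Real.exp_nat_mul, ← Real.exp_add]
      congr 1
      push_cast
      ring
    have h3 : Real.exp (-absSum k) ≤ 1 := Real.exp_le_one_iff.2 (by linarith [absSum_nonneg k])
    have h4 : Real.exp (16 * Real.pi ^ 2) = Real.exp (8 * Real.pi ^ 2) ^ 2 := by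
      rw [← Real.exp_nat_mul]
      congr 1
      push_cast
      ring
    rw [h2] at h1
    have h5 : Real.exp (-eigenvalue k * t) ^ 2
        ≤ q ^ 4 * Real.exp (16 * Real.pi ^ 2) * Real.exp (-absSum k) := by
      calc _ ≤ (q ^ 2 * Real.exp (8 * Real.pi ^ 2) * Real.exp (-absSum k)) ^ 2 := by
            gcongr
        _ = q ^ 4 * Real.exp (16 * Real.pi ^ 2)
            * (Real.exp (-absSum k) * Real.exp (-absSum k)) := by rw [h4]; ring
        _ ≤ q ^ 4 * Real.exp (16 * Real.pi ^ 2) * (Real.exp (-absSum k) * 1) := by gcongr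
        _ = _ := by rw [mul_one]
    linarith [sq_nonneg (c k t)]
  have hmain := hasSum_le hle (hF.sub hrest) (hA.sub hB)
  rw [hFS] at hmain
  have h1 : Y ^ 2 ≤ 2 * (y₁ ^ 2 + y₂ ^ 2) := by nlinarith [sq_nonneg (y₁ - y₂)]
  have h2 : 0 < q ^ 2 * (Y ^ 2 - 4 - q ^ 2 * (Real.exp (16 * Real.pi ^ 2) * Z)) :=
    mul_pos (by positivity) (by linarith)
  have h3 : q ^ 2 * Y ^ 2 ≤ q ^ 2 * (2 * (y₁ ^ 2 + y₂ ^ 2)) := by gcongr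
  nlinarith

/-- While a weak shear acts, the sum of the two normalized first coefficients grows strictly, and
it does not decrease afterwards. -/
theorem exists_lt_exp_mul_add {i j : Fin d} (hij : i ≠ j) {ρ : ℝ → ℝ} {c : (Fin d → ℤ) → ℝ → ℝ}
    {t₀ t₁ δ : ℝ} (ht₀ : 1 ≤ t₀) (h01 : t₀ < t₁) (hρ0 : ∀ t, 0 ≤ ρ t)
    (hρpos : ∀ t ∈ Ioo t₀ t₁, 0 < ρ t) (hρoff : ∀ t, t₁ ≤ t → ρ t = 0)
    (hode : CoeffODE ρ (shearDir i j) (planeFreq i j 1 2) c)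
    (hcc : ∀ k, Continuous (c k)) (hheat : ∀ k, ∀ t ≤ t₀, c k t = Real.exp (-eigenvalue k * t))
    (hc : ∀ k t, |c k t - Real.exp (-eigenvalue k * t)| ≤ δ)
    (hδ : 12 * δ < Real.exp (-(4 * Real.pi ^ 2 * t₁)) ^ 2) :
    ∃ Y, 2 < Y ∧ ∀ t, t₁ ≤ t → Y ≤ Real.exp (4 * Real.pi ^ 2 * t) * c (planeFreq i j 1 0) t
      + Real.exp (4 * Real.pi ^ 2 * t) * c (planeFreq i j 0 1) t := by
  set f : ℝ → ℝ := fun t => Real.exp (4 * Real.pi ^ 2 * t) * c (planeFreq i j 1 0) t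
      + Real.exp (4 * Real.pi ^ 2 * t) * c (planeFreq i j 0 1) t with hf
  have n₁ : normSq (planeFreq i j 1 0) = 1 := by rw [normSq_planeFreq hij]; norm_num
  have n₂ : normSq (planeFreq i j 0 1) = 1 := by rw [normSq_planeFreq hij]; norm_num
  have hfc : Continuous f := by
    have h1 := hcc (planeFreq i j 1 0)
    have h2 := hcc (planeFreq i j 0 1)
    fun_prop
  have hder : ∀ t, 0 < t → HasDerivAt f (Real.exp (4 * Real.pi ^ 2 * t)
      * (coupling ρ (shearDir i j) (planeFreq i j 1 2) c (planeFreq i j 1 0) t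
        + coupling ρ (shearDir i j) (planeFreq i j 1 2) c (planeFreq i j 0 1) t)) t := fun t ht =>
    ((hode.hasDerivAt_exp_mul n₁ ht).add (hode.hasDerivAt_exp_mul n₂ ht)).congr_deriv (by ring)
  have hpos : ∀ t ∈ Ioo t₀ t₁, 0 < deriv f t := by
    intro t ht
    rw [(hder t (by linarith [ht.1])).deriv]
    have hlow : Real.exp (-(4 * Real.pi ^ 2 * t₁)) ^ 2 ≤ Real.exp (-(4 * Real.pi ^ 2 * t)) ^ 2 := by
      gcongr
      exact ht.2.le
    refine mul_pos (Real.exp_pos _) (lt_of_lt_of_le ?_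
      (coupling_add_coupling_ge hij (by linarith [ht.1]) (hρ0 t) (fun k => hc k t)))
    exact mul_pos (mul_pos Real.pi_pos (hρpos t ht)) (by linarith)
  have hzero : ∀ t, t₁ < t → deriv f t = 0 := by
    intro t ht
    rw [(hder t (by linarith)).deriv]
    simp [coupling, hρoff t ht.le]
  have h2 : f t₀ = 2 := by
    simp only [hf, hheat _ t₀ le_rfl, eigenvalue, n₁, n₂, mul_one]
    rw [← Real.exp_add]
    simp
    norm_num
  have hstrict : StrictMonoOn f (Icc t₀ t₁) := strictMonoOn_of_deriv_pos (convex_Icc _ _)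
    hfc.continuousOn (by rwa [interior_Icc])
  have hmono : MonotoneOn f (Ici t₁) := monotoneOn_of_deriv_nonneg (convex_Ici _) hfc.continuousOn
    (fun t ht => by
      rw [interior_Ici] at ht
      exact (hder t (by linarith [mem_Ioi.1 ht])).differentiableAt.differentiableWithinAt)
    (fun t ht => by
      rw [interior_Ici] at ht
      exact (hzero t ht).ge)
  refine ⟨f t₁, ?_, fun t ht => hmono self_mem_Ici ht ht⟩
  rw [← h2]
  exact hstrict (left_mem_Icc.2 h01.le) (right_mem_Icc.2 h01.le) h01

theorem shear_zero (w : Fin d → ℝ) (m : Fin d → ℤ) : shear (fun _ => 0) w m = fun _ _ => 0 := by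
  funext t x i
  simp [shear]

end FlatTorus

theorem mainTheorem4 (d : ℕ) (hd : 2 ≤ d) :
    ∃ u : ℝ → FlatTorus d → Fin d → ℝ,
      FlatTorus.IsSmoothField u ∧
      (∀ t : ℝ, 0 ≤ t → ∀ x, FlatTorus.divergence (u t) x = 0) ∧
      (∃ S : ℝ, ∀ t : ℝ, S ≤ t → ∀ x, u t x = 0) ∧
      ∃ θ φ : ℝ → FiniteMeasure (FlatTorus d),
        FlatTorus.IsTheSolution u (FlatTorus.diracZero d) θ ∧
        FlatTorus.IsTheSolution (fun _ _ => 0) (FlatTorus.diracZero d) φ ∧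
        ∃ T : ℝ, 0 < T ∧
          (∀ t : ℝ, T ≤ t →
            FlatTorus.l2Norm (φ t) < FlatTorus.l2Norm (θ t) ∧ FlatTorus.l2Norm (θ t) < ⊤) ∧
          (∀ t : ℝ, T < t → ¬ FlatTorus.LessConcentrated (θ t) (φ t)) := by
  open FlatTorus Filter Topology in
  obtain ⟨i, j, hij⟩ : ∃ i j : Fin d, i ≠ j :=
    ⟨⟨0, by omega⟩, ⟨1, by omega⟩, by simp [Fin.ext_iff]⟩
  set w := shearDir i j with hw
  set m := planeFreq i j 1 2 with hm
  set Z := ∑' k : Fin d → ℤ, Real.exp (-absSum k) with hZ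
  have hZ0 : 0 ≤ Z := tsum_nonneg fun k => (Real.exp_pos _).le
  -- the heat kernel is at least `1/2` from time `t₀` on
  set t₀ : ℝ := 1 + 2 * Z with ht₀
  have ht₀1 : 1 ≤ t₀ := by linarith
  have hheat : Real.exp (-(t₀ - 1)) * Z ≤ 1 / 2 := by
    rw [Real.exp_neg, inv_mul_le_iff₀ (Real.exp_pos _)]
    linarith [Real.add_one_le_exp (t₀ - 1)]
  have hwpos : 0 < vecSum w := by
    have h1 : |w i| ≤ vecSum w :=
      Finset.single_le_sum (f := fun l => |w l|) (fun _ _ => abs_nonneg _) (Finset.mem_univ i)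
    have h2 : w i = 2 := by simp [hw, shearDir, hij]
    rw [h2] at h1
    exact lt_of_lt_of_le (by norm_num) h1
  -- `δ` is the size of the perturbation of the heat kernel, `ε` that of the shear
  set q := Real.exp (-(4 * Real.pi ^ 2 * (t₀ + 2))) with hq
  have hq0 : 0 < q := Real.exp_pos _
  have hq1 : q < 1 / 4 := exp_neg_four_pi_sq_mul_lt (by linarith)
  set δ : ℝ := q ^ 2 / (24 * (Z + 1)) with hδ
  have hδ0 : 0 < δ := by positivity
  have hδZ : δ * (24 * (Z + 1)) = q ^ 2 := div_mul_cancel₀ _ (by positivity)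
  have hq2 : q ^ 2 ≤ 1 := by nlinarith
  have hδZ0 : 0 ≤ δ * Z := by positivity
  set ε : ℝ := δ / (vecSum w * Real.exp (absSum m)) with hε
  have hε0 : 0 < ε := by positivity
  have hεδ : ε * vecSum w * Real.exp (absSum m) = δ := by
    rw [mul_assoc]
    exact div_mul_cancel₀ _ (by positivity)
  let η : ContDiffBump (t₀ + 1) := ⟨1 / 2, 1, by norm_num, by norm_num⟩
  set ρ : ℝ → ℝ := fun t => ε * η t with hρdef
  have hρsmooth : ContDiff ℝ ∞ ρ := contDiff_const.mul η.contDiff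
  have hρ0 : ∀ t, 0 ≤ ρ t := fun t => mul_nonneg hε0.le η.nonneg
  have hρε : ∀ t, |ρ t| ≤ ε := fun t => by
    rw [abs_of_nonneg (hρ0 t)]
    exact mul_le_of_le_one_right hε0.le η.le_one
  have hρbefore : ∀ t ≤ t₀, ρ t = 0 := fun t ht => by
    have h1 : η t = 0 := η.zero_of_le_dist (by
      change 1 ≤ |t - (t₀ + 1)|
      rw [abs_of_nonpos (by linarith)]
      linarith)
    simp [hρdef, h1]
  have hρafter : ∀ t, t₀ + 2 ≤ t → ρ t = 0 := fun t ht => by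
    have h1 : η t = 0 := η.zero_of_le_dist (by
      change 1 ≤ |t - (t₀ + 1)|
      rw [abs_of_nonneg (by linarith)]
      linarith)
    simp [hρdef, h1]
  have hρpos : ∀ t ∈ Ioo t₀ (t₀ + 2), 0 < ρ t := fun t ht =>
    mul_pos hε0 (η.pos_of_mem_ball (by
      change |t - (t₀ + 1)| < 1
      rw [abs_lt]
      constructor <;> linarith [ht.1, ht.2]))
  obtain ⟨c, θ, hode, hcc, hsym, hch, hcδ, hθ, hθd⟩ := exists_isTheSolution_shear
    (ρ := ρ) (ε := ε) (t₀ := t₀) (w := w) (m := m) hρsmooth.continuous hρε hρbefore ht₀1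
    (by rw [hεδ]; nlinarith) hheat (by rw [hεδ]; linarith)
  obtain ⟨c', φ, hode', hcc', -, hch', hcδ', hφ, hφd⟩ := exists_isTheSolution_shear
    (ρ := fun _ => 0) (ε := 0) (t₀ := t₀) (w := w) (m := m) continuous_const (by simp) (by simp)
    ht₀1 (by simp) hheat (by simp)
  rw [shear_zero] at hφ
  have hc' : ∀ k t, c' k t = Real.exp (-eigenvalue k * t) := fun k t => by
    have := hcδ' k t
    simp only [zero_mul] at this
    exact sub_eq_zero.1 (abs_nonpos_iff.1 this)
  simp only [hc'] at hφd
  obtain ⟨Y, hY, hYle⟩ := exists_lt_exp_mul_add hij (δ := δ) ht₀1 (show t₀ < t₀ + 2 by linarith)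
    hρ0 hρpos hρafter hode hcc hch (fun k t => by
      refine (hcδ k t).trans ?_
      rw [hεδ]
      exact mul_le_of_le_one_right hδ0.le
        (Real.exp_le_one_iff.2 (by linarith [absSum_nonneg k]))) (by nlinarith)
  have hlim : Tendsto (fun t : ℝ => Real.exp (-(4 * Real.pi ^ 2 * t)) ^ 2
      * (Real.exp (16 * Real.pi ^ 2) * Z)) atTop (𝓝 0) := by
    have h1 : Tendsto (fun t : ℝ => Real.exp (-(4 * Real.pi ^ 2 * t))) atTop (𝓝 0) :=
      Real.tendsto_exp_neg_atTop_nhds_zero.comp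
        (tendsto_id.const_mul_atTop (by positivity))
    simpa using (h1.pow 2).mul_const (Real.exp (16 * Real.pi ^ 2) * Z)
  obtain ⟨T₁, hT₁⟩ := eventually_atTop.1
    (hlim.eventually_lt_const (show 0 < Y ^ 2 - 4 by nlinarith))
  have key : ∀ t, max T₁ (t₀ + 2) ≤ t → ∃ f g : C(FlatTorus d, ℝ),
      (∀ x, 0 ≤ f x) ∧ (∀ x, 0 ≤ g x) ∧
      (θ t : Measure (FlatTorus d)) = volume.withDensity (fun x => ENNReal.ofReal (f x)) ∧
      (φ t : Measure (FlatTorus d)) = volume.withDensity (fun x => ENNReal.ofReal (g x)) ∧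
      ∫ x, g x ^ 2 < ∫ x, f x ^ 2 := by
    intro t ht
    have ht1 := (le_max_left _ _).trans ht
    have ht2 := (le_max_right _ _).trans ht
    obtain ⟨f, hf0, hfθ, hfs⟩ := hθd t (by linarith)
    obtain ⟨g, hg0, hgφ, hgs⟩ := hφd t (by linarith)
    refine ⟨f, g, hf0, hg0, hfθ, hgφ, ?_⟩
    exact sum_sq_gt hij hode hcc hsym (fun k => by rw [hch k 0 (by linarith)]; simp)
      (by linarith) hY (hYle t ht2) (hT₁ t ht1) hfs hgs
  refine ⟨shear ρ w m, isSmoothField_shear hρsmooth w m, fun t _ x => divergence_shear ρ ?_ t x,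
    ⟨t₀ + 2, fun t ht x => ?_⟩, θ, φ, hθ, hφ, max T₁ (t₀ + 2),
    lt_max_of_lt_right (by linarith), fun t ht => ?_, fun t ht hless => ?_⟩
  · rw [hw, hm, pairing_planeFreq hij]
    norm_num
  · funext l
    simp [shear, hρafter t ht]
  · obtain ⟨f, g, hf0, hg0, hfθ, hgφ, hlt⟩ := key t ht
    rw [l2Norm_of_density hfθ hf0, l2Norm_of_density hgφ hg0]
    refine ⟨ENNReal.rpow_lt_rpow ?_ (by norm_num),
      ENNReal.rpow_lt_top_of_nonneg (by norm_num) ENNReal.ofReal_ne_top⟩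
    exact (ENNReal.ofReal_lt_ofReal_iff
      ((integral_nonneg fun x => sq_nonneg _).trans_lt hlt)).2 hlt
  · obtain ⟨f, g, hf0, hg0, hfθ, hgφ, hlt⟩ := key t ht.le
    exact hlt.not_ge (integral_sq_le_of_lessConcentrated hfθ hgφ hf0 hg0 hless)
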